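/- **Conventions.** Let $L$ be a language consisting of relation symbols (of arities $\ge 1$) and unary function symbols, and let $\Gamma_L$ be a group of permutations of $L$ that preserve types and arities of symbols. A *$\Gamma_L$-structure* $\mathbf A$ has a vertex set $A$ (possibly empty), a relation $R_{\mathbf A}\subseteq A^{a(R)}$ for every relation symbol $R$ of arity $a(R)$, and a function $F_{\mathbf A}\colon A\to\mathcal P(A)$ for every function symbol $F$. A *homomorphism* $f\colon\mathbf A\to\mathbf B$ is a pair $(f_L,f_A)$ with $f_L\in\Gamma_L$ and $f_A\colon A\to B$ such that $\bar x\in R_{\mathbf A}$ implies $f_A(\bar x)\in f_L(R)_{\mathbf B}$, and $f_A(F_{\mathbf A}(x))\subseteq f_L(F)_{\mathbf B}(f_A(x))$. It is an *embedding* if $f_A$ is injective and these hold with "if and only if" and "$=$", respectively; an *isomorphism* is an embedding with $f_A$ bijective. Maps are composed, compared and extended both on the vertices and on the language. A *substructure* of $\mathbf A$ is the structure induced on a set of vertices closed under all functions. A structure is *irreducible* if it is not the free amalgamation of two proper substructures, i.e. it is not covered by two proper substructures $\mathbf U_1,\mathbf U_2$ such that no tuple in a relation meets both $U_1\setminus U_2$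 and $U_2\setminus U_1$. A *homomorphism-embedding* is a homomorphism whose restriction to every irreducible substructure is an embedding. A *partial automorphism* of $\mathbf A$ is an isomorphism between substructures of $\mathbf A$. A triple $(f,g,h)$ of partial automorphisms is *coherent* if $\mathrm{Dom}(f)=\mathrm{Dom}(h)$, $\mathrm{Range}(f)=\mathrm{Dom}(g)$, $\mathrm{Range}(g)=\mathrm{Range}(h)$ and $h=g\circ f$. $\mathbf B$ is an *EPPA-witness* for $\mathbf A$ if there is an embedding $\psi\colon\mathbf A\to\mathbf B$ such that every partial automorphism $f$ of $\psi(\mathbf A)$ extends to an automorphism $\hat f$ of $\mathbf B$; it is a *coherent* EPPA-witness if $\psi$ and the extensions can be chosen so that $\hat h=\hat g\circ\hat f$ for every coherent triple $(f,g,h)$. A class $\mathcal C$ of finite $\Gamma_L$-structures has (*coherent*) *EPPA* if every $\mathbf A\in\mathcal C$ has a (coherent) EPPA-witness in $\mathcal C$. It is *hereditary* if $\mathbf A\in\mathcal C$ and an embedding $\mathbf B\to\mathbf A$ imply $\mathbf B\in\mathcal C$. It has the *amalgamation property* if for all embeddings $\alpha_i\colon\mathbf A\to\mathbf B_i$ ($i=1,2$)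 with $\mathbf A,\mathbf B_1,\mathbf B_2\in\mathcal C$ there are $\mathbf C\in\mathcal C$ and embeddings $\beta_i\colon\mathbf B_i\to\mathbf C$ with $\beta_1\circ\alpha_1=\beta_2\circ\alpha_2$. An irreducible structure $\mathbf C'$ is a *completion* of $\mathbf C$ if there is a homomorphism-embedding $\mathbf C\to\mathbf C'$. It is an *automorphism-preserving* completion if moreover there are an injective homomorphism-embedding $f\colon\mathbf C\to\mathbf C'$ and a group homomorphism $\mathrm{Aut}(\mathbf C)\to\mathrm{Aut}(\mathbf C')$, $\alpha\mapsto\alpha'$, with $\alpha'\circ f=f\circ\alpha$ for all $\alpha$. Let $\mathcal E$ be a class of finite $\Gamma_L$-structures and $\mathcal K\subseteq\mathcal E$ a subclass consisting of irreducible structures. $\mathcal K$ is a *locally finite automorphism-preserving subclass* of $\mathcal E$ if for all $\mathbf A\in\mathcal K$ and $\mathbf B_0\in\mathcal E$ there is an integer $n=n(\mathbf A,\mathbf B_0)$ such that every finite $\Gamma_L$-structure $\mathbf B$ has an automorphism-preserving completion $\mathbf B'\in\mathcal K$, provided that 1. every irreducible substructure of $\mathbf B$ has an embedding to $\mathbf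 A$, 2. there is a homomorphism-embedding $\mathbf B\to\mathbf B_0$, and 3. every substructure of $\mathbf B$ on at most $n$ vertices has a completion in $\mathcal K$. **Theorem.** Let $L$ be a language consisting of relation and unary function symbols equipped with a permutation group $\Gamma_L$, and let $\mathcal E$ be a class of finite $\Gamma_L$-structures which has EPPA. Let $\mathcal K$ be a hereditary locally finite automorphism-preserving subclass of $\mathcal E$ with the amalgamation property which consists of irreducible structures. Then $\mathcal K$ has EPPA. Moreover, if $\mathcal E$ has coherent EPPA, then $\mathcal K$ has coherent EPPA. -/

import Mathlib

universe u v w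

namespace GammaL

/-- A language of relation symbols (of arities `n ≥ 1`) and unary function symbols. -/
structure Lang where
  /-- the relation symbols of arity `n` -/
  Rel : ℕ+ → Type u
  /-- the (unary) function symbols -/
  Fn : Type v

/-- The group of all permutations of the language that preserve types and arities of symbols.
A language equipped with a permutation group is a language together with a subgroup `Γ` of it. -/
abbrev Lang.SymPerm (L : Lang.{u, v}) : Type (max u v) :=
  (∀ n : ℕ+, Equiv.Perm (L.Rel n)) × Equiv.Perm L.Fn

/-- A structure: a vertex set, a relation for every relation symbol, and for every function symbol
a function from vertices to *sets* of vertices. -/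
structure Struc (L : Lang.{u, v}) where
  V : Type w
  rel : ∀ {n : ℕ+}, L.Rel n → Set (Fin n → V)
  fn : L.Fn → V → Set V

variable {L : Lang.{u, v}}

/-- A substructure of `A`, given by its vertex set: a set of vertices closed under all functions. -/
@[ext] structure Substruc (A : Struc.{u, v, w} L) where
  carrier : Set A.V
  closed : ∀ (F : L.Fn), ∀ x ∈ carrier, A.fn F x ⊆ carrier

/-- The structure that `A` induces on (the vertex set of) a substructure. -/
def Substruc.toStruc {A : Struc.{u, v, w} L} (S : Substruc A) : Struc.{u, v, w} L where
  V := S.carrier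
  rel := fun R => {x | (fun i => (x i : A.V)) ∈ A.rel R}
  fn := fun F x => {y | (y : A.V) ∈ A.fn F (x : A.V)}

/-- A homomorphism: a permutation `lang ∈ Γ` of the language together with a map of vertices. -/
@[ext] structure Hom (Γ : Subgroup L.SymPerm) (A B : Struc.{u, v, w} L) where
  lang : Γ
  toFun : A.V → B.V
  map_rel : ∀ {n : ℕ+} (R : L.Rel n) (x : Fin n → A.V),
    x ∈ A.rel R → (fun i => toFun (x i)) ∈ B.rel (lang.1.1 n R)
  map_fn : ∀ (F : L.Fn) (x : A.V), toFun '' A.fn F x ⊆ B.fn (lang.1.2 F) (toFun x)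

variable {Γ : Subgroup L.SymPerm} {A B C : Struc.{u, v, w} L}

/-- Composition of homomorphisms (both of the vertex maps and of the language permutations). -/
def Hom.comp (g : Hom Γ B C) (f : Hom Γ A B) : Hom Γ A C where
  lang := g.lang * f.lang
  toFun := fun x => g.toFun (f.toFun x)
  map_rel := fun R x hx => g.map_rel _ _ (f.map_rel R x hx)
  map_fn := by
    rintro F x _ ⟨y, hy, rfl⟩
    exact g.map_fn _ _ ⟨_, f.map_fn F x ⟨y, hy, rfl⟩, rfl⟩

/-- Restriction of a homomorphism to a substructure of its domain. -/
def Hom.restrict (f : Hom Γ A B) (S : Substruc A) : Hom Γ S.toStruc B where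
  lang := f.lang
  toFun := fun x => f.toFun x.1
  map_rel := fun R x hx => f.map_rel R (fun i => (x i).1) hx
  map_fn := by
    rintro F x _ ⟨y, hy, rfl⟩
    exact f.map_fn F x.1 ⟨y.1, hy, rfl⟩

/-- A homomorphism is an embedding if it is injective on vertices, preserves relations in both
directions, and satisfies the condition on functions with equality. -/
structure Hom.IsEmbedding (f : Hom Γ A B) : Prop where
  injective : Function.Injective f.toFun
  rel_iff : ∀ {n : ℕ+} (R : L.Rel n) (x : Fin n → A.V),
    x ∈ A.rel R ↔ (fun i => f.toFun (x i)) ∈ B.rel (f.lang.1.1 n R)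
  fn_eq : ∀ (F : L.Fn) (x : A.V), f.toFun '' A.fn F x = B.fn (f.lang.1.2 F) (f.toFun x)

/-- An isomorphism is an embedding that is surjective on vertices. -/
structure Hom.IsIsomorphism (f : Hom Γ A B) : Prop extends f.IsEmbedding where
  surjective : Function.Surjective f.toFun

/-- The image `ψ(A)` of an embedding `ψ : A → B`, which is a substructure of `B`. -/
def Hom.image (f : Hom Γ A B) (hf : f.IsEmbedding) : Substruc B where
  carrier := Set.range f.toFun
  closed := by
    rintro F _ ⟨x, rfl⟩ y hy
    have h := hf.fn_eq (f.lang.1.2.symm F) x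
    rw [Equiv.apply_symm_apply] at h
    rw [← h] at hy
    obtain ⟨z, -, rfl⟩ := hy
    exact ⟨z, rfl⟩

/-- `A` is the free amalgamation of its substructures `U₁` and `U₂` (over `U₁ ∩ U₂`): they cover
`A`, and no tuple in a relation of `A` meets both `U₁ \ U₂` and `U₂ \ U₁`. (The analogous condition
on functions is void, as functions are unary.) -/
def IsFreeAmalgamOf (A : Struc.{u, v, w} L) (U₁ U₂ : Substruc A) : Prop :=
  U₁.carrier ∪ U₂.carrier = Set.univ ∧
  ∀ {n : ℕ+} (R : L.Rel n), ∀ x ∈ A.rel R,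
    ¬ ((∃ i, x i ∈ U₁.carrier \ U₂.carrier) ∧ (∃ j, x j ∈ U₂.carrier \ U₁.carrier))

/-- A structure is irreducible if it is not the free amalgamation of two proper substructures. -/
def IsIrreducible (A : Struc.{u, v, w} L) : Prop :=
  ¬ ∃ U₁ U₂ : Substruc A,
    U₁.carrier ≠ Set.univ ∧ U₂.carrier ≠ Set.univ ∧ IsFreeAmalgamOf A U₁ U₂

/-- A homomorphism-embedding: a homomorphism whose restriction to every irreducible substructure
is an embedding. -/
def Hom.IsHomEmbedding (f : Hom Γ A B) : Prop :=
  ∀ S : Substruc A, IsIrreducible S.toStruc → (f.restrict S).IsEmbedding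

/-- The automorphism group of `A`: pairs of a language permutation in `Γ` and a permutation of the
vertices that form an isomorphism from `A` to itself. -/
def Aut (Γ : Subgroup L.SymPerm) (A : Struc.{u, v, w} L) : Subgroup (Γ × Equiv.Perm A.V) where
  carrier := {a |
    (∀ {n : ℕ+} (R : L.Rel n) (x : Fin n → A.V),
      x ∈ A.rel R ↔ (fun i => a.2 (x i)) ∈ A.rel (a.1.1.1 n R)) ∧
    (∀ (F : L.Fn) (x : A.V), a.2 '' A.fn F x = A.fn (a.1.1.2 F) (a.2 x))}
  mul_mem' := by
    rintro a b ⟨ha, ha'⟩ ⟨hb, hb'⟩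
    refine ⟨fun R x => (hb R x).trans (ha _ _), fun F x => ?_⟩
    have h := ha' (b.1.1.2 F) (b.2 x)
    rw [← hb', Set.image_image] at h
    exact h
  one_mem' := ⟨fun _ _ => Iff.rfl, fun F x => Set.image_id _⟩
  inv_mem' := by
    rintro a ⟨ha, ha'⟩
    refine ⟨fun {n} R x => ?_, fun F x => ?_⟩
    · have h := ha ((a.1.1.1 n).symm R) (fun i => a.2.symm (x i))
      simp only [Equiv.apply_symm_apply] at h
      exact h.symm
    · have h := ha' (a.1.1.2.symm F) (a.2.symm x)
      simp only [Equiv.apply_symm_apply] at h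
      rw [← h]
      change a.2.symm '' _ = A.fn (a.1.1.2.symm F) (a.2.symm x)
      rw [Set.image_image]
      simp

/-- A partial automorphism of `A`: an isomorphism between two substructures of `A`
(including its language permutation). -/
structure PartialAut (Γ : Subgroup L.SymPerm) (A : Struc.{u, v, w} L) where
  dom : Substruc A
  cod : Substruc A
  hom : Hom Γ dom.toStruc cod.toStruc
  isIso : hom.IsIsomorphism

/-- The value of a partial automorphism at a vertex of its domain, as a vertex of `A`. -/
def PartialAut.app (p : PartialAut Γ A) (x : A.V) (hx : x ∈ p.dom.carrier) : A.V :=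
  (p.hom.toFun ⟨x, hx⟩ : p.cod.carrier).1

/-- The value of a partial automorphism lies in its range. -/
theorem PartialAut.app_mem (p : PartialAut Γ A) (x : A.V) (hx : x ∈ p.dom.carrier) :
    p.app x hx ∈ p.cod.carrier :=
  (p.hom.toFun ⟨x, hx⟩ : p.cod.carrier).2

/-- The automorphism `a` of `B` extends the partial automorphism `p` of a substructure `S` of `B`
(on the vertices and on the language). -/
def Extends {S : Substruc B} (a : Aut Γ B) (p : PartialAut Γ S.toStruc) : Prop :=
  a.1.1 = p.hom.lang ∧
  ∀ (x : S.carrier) (hx : x ∈ p.dom.carrier),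
    a.1.2 x.1 = (show S.carrier from p.app x hx).1

/-- `(f, g, h)` is a coherent triple: `Dom f = Dom h`, `Range f = Dom g`, `Range g = Range h` and
`h = g ∘ f` (on the vertices and on the language). -/
def CoherentTriple (f g h : PartialAut Γ A) : Prop :=
  f.dom = h.dom ∧ g.cod = h.cod ∧ h.hom.lang = g.hom.lang * f.hom.lang ∧
  ∃ e : f.cod = g.dom, ∀ (x : A.V) (hf : x ∈ f.dom.carrier) (hh : x ∈ h.dom.carrier),
    h.app x hh = g.app (f.app x hf) (e ▸ f.app_mem x hf)

/-- `B` is an EPPA-witness for `A`: there is an embedding `ψ : A → B` such that every partial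
automorphism of `ψ(A)` extends to an automorphism of `B`. -/
def IsEPPAWitness (Γ : Subgroup L.SymPerm) (A B : Struc.{u, v, w} L) : Prop :=
  ∃ (ψ : Hom Γ A B) (hψ : ψ.IsEmbedding),
    ∀ p : PartialAut Γ (ψ.image hψ).toStruc, ∃ a : Aut Γ B, Extends a p

/-- `B` is a coherent EPPA-witness for `A`: the extensions can be chosen so that the image of every
coherent triple of partial automorphisms of `ψ(A)` is coherent. -/
def IsCoherentEPPAWitness (Γ : Subgroup L.SymPerm) (A B : Struc.{u, v, w} L) : Prop :=
  ∃ (ψ : Hom Γ A B) (hψ : ψ.IsEmbedding)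
    (φ : PartialAut Γ (ψ.image hψ).toStruc → Aut Γ B),
    (∀ p, Extends (φ p) p) ∧
    ∀ f g h, CoherentTriple f g h → φ h = φ g * φ f

/-- The extension property for partial automorphisms of a class of structures. -/
def HasEPPA (Γ : Subgroup L.SymPerm) (K : Set (Struc.{u, v, w} L)) : Prop :=
  ∀ A ∈ K, ∃ B ∈ K, IsEPPAWitness Γ A B

/-- Coherent EPPA of a class of structures. -/
def HasCoherentEPPA (Γ : Subgroup L.SymPerm) (K : Set (Struc.{u, v, w} L)) : Prop :=
  ∀ A ∈ K, ∃ B ∈ K, IsCoherentEPPAWitness Γ A B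

/-- The hereditary property. (It includes closure under isomorphisms.) -/
def IsHereditary (Γ : Subgroup L.SymPerm) (K : Set (Struc.{u, v, w} L)) : Prop :=
  ∀ A ∈ K, ∀ B : Struc.{u, v, w} L, (∃ f : Hom Γ B A, f.IsEmbedding) → B ∈ K

/-- The amalgamation property. -/
def HasAmalgamation (Γ : Subgroup L.SymPerm) (K : Set (Struc.{u, v, w} L)) : Prop :=
  ∀ A ∈ K, ∀ B₁ ∈ K, ∀ B₂ ∈ K, ∀ (α₁ : Hom Γ A B₁) (α₂ : Hom Γ A B₂),
    α₁.IsEmbedding → α₂.IsEmbedding →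
    ∃ C ∈ K, ∃ (β₁ : Hom Γ B₁ C) (β₂ : Hom Γ B₂ C),
      β₁.IsEmbedding ∧ β₂.IsEmbedding ∧ β₁.comp α₁ = β₂.comp α₂

/-- `C'` is a completion of `C`: it is irreducible and there is a homomorphism-embedding
`C → C'`. -/
def IsCompletion (Γ : Subgroup L.SymPerm) (C C' : Struc.{u, v, w} L) : Prop :=
  IsIrreducible C' ∧ ∃ f : Hom Γ C C', f.IsHomEmbedding

/-- `C'` is an automorphism-preserving completion of `C`: it is irreducible, there is an injective
homomorphism-embedding `f : C → C'`, and there is a group homomorphism `Φ : Aut C → Aut C'` such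
that `Φ a` extends `a` along `f`, that is, `Φ a ∘ f = f ∘ a`
(on the vertices and on the language). -/
def IsAutPreservingCompletion (Γ : Subgroup L.SymPerm) (C C' : Struc.{u, v, w} L) : Prop :=
  IsIrreducible C' ∧
  ∃ f : Hom Γ C C', f.IsHomEmbedding ∧ Function.Injective f.toFun ∧
    ∃ Φ : Aut Γ C →* Aut Γ C', ∀ a : Aut Γ C,
      (Φ a).1.1 * f.lang = f.lang * a.1.1 ∧
      ∀ x : C.V, (Φ a).1.2 (f.toFun x) = f.toFun (a.1.2 x)

/-- `K` is a locally finite automorphism-preserving subclass of `E`. -/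
def IsLocallyFiniteAutPreserving (Γ : Subgroup L.SymPerm) (K E : Set (Struc.{u, v, w} L)) : Prop :=
  K ⊆ E ∧
  ∀ A ∈ K, ∀ B₀ ∈ E, ∃ n : ℕ, ∀ B : Struc.{u, v, w} L, Finite B.V →
    (∀ S : Substruc B, IsIrreducible S.toStruc → ∃ f : Hom Γ S.toStruc A, f.IsEmbedding) →
    (∃ f : Hom Γ B B₀, f.IsHomEmbedding) →
    (∀ S : Substruc B, S.carrier.ncard ≤ n → ∃ C ∈ K, IsCompletion Γ S.toStruc C) →
    ∃ B' ∈ K, IsAutPreservingCompletion Γ B B'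

end GammaL

/-! Let `B` in the larger class be an EPPA-witness for `A`. Local finiteness turns a finite
structure over `B` into a member of `K`, and carries its automorphisms along, as soon as its
irreducible substructures embed in `A` and its small substructures have completions. Such a
structure is obtained from `B` by iterating a covering construction to which the copy of `A` and the
chosen extensions lift.

Call the substructures of `B` that embed in `A` charts. Passing between charts through common
subcharts is recorded by chains modulo 2 (`IsFlow`). A vertex of the cover is a vertex `v` of `B`
labelled by a flow from a base chart to a chart containing `v`, where the rows of charts containing
`v` are forgotten. Cells are the lifts of charts. Two combinatorial facts carry the proof. Points
that pairwise share cells lie in one cell (`exists_flowCell_of_pairwise`), so irreducible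
substructures of the cover embed in `A`. The cover is also tree-like (`exists_separation`): a finite
set that lies in no cell, but in which points over a common chart share a cell, is separated by the
intersection of two cells.

Completability then follows by induction on the number of pairs that share no chart
(`completable_of_defect_lt`). A substructure of the cover lies in a cell, or its projection has
fewer such pairs, or it is a free amalgamation, over a structure that embeds in `A`, of two parts
with fewer such pairs; the amalgamation property joins completions of the parts.

An automorphism lifts together with a flow from the base chart to its image. If it extends a partial
automorphism, the flow through the image of the range keeps the lifted copy of `A` in place, and
these flows satisfy a cocycle identity (`bridge_mul`), so coherence survives. -/

namespace GammaL

/-! ### Embeddings, substructures and irreducibility -/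

variable {L : Lang.{u, v}} {Γ : Subgroup L.SymPerm} {A B C : Struc.{u, v, w} L}

theorem Hom.IsEmbedding.comp {g : Hom Γ B C} {f : Hom Γ A B} (hg : g.IsEmbedding)
    (hf : f.IsEmbedding) : (g.comp f).IsEmbedding where
  injective := hg.injective.comp hf.injective
  rel_iff R x := (hf.rel_iff R x).trans (hg.rel_iff _ _)
  fn_eq F x := by
    have h := hg.fn_eq (f.lang.1.2 F) (f.toFun x)
    rw [← hf.fn_eq, Set.image_image] at h
    exact h

/-- The inclusion of a substructure. -/
def Substruc.incl (Γ : Subgroup L.SymPerm) (S : Substruc A) : Hom Γ S.toStruc A where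
  lang := 1
  toFun x := x.1
  map_rel _ _ hx := hx
  map_fn := by
    rintro F x _ ⟨y, hy, rfl⟩
    exact hy

theorem Substruc.incl_isEmbedding (S : Substruc A) : (S.incl Γ).IsEmbedding where
  injective := Subtype.val_injective
  rel_iff _ _ := Iff.rfl
  fn_eq F x := by
    refine Set.Subset.antisymm ((S.incl Γ).map_fn F x) fun y hy => ?_
    exact ⟨⟨y, S.closed F x.1 x.2 hy⟩, hy, rfl⟩

/-- A homomorphism with values in a substructure, as a homomorphism to that substructure. -/
def Hom.codRestrict (f : Hom Γ A B) (S : Substruc B) (h : ∀ x, f.toFun x ∈ S.carrier) :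
    Hom Γ A S.toStruc where
  lang := f.lang
  toFun x := ⟨f.toFun x, h x⟩
  map_rel R x hx := f.map_rel R x hx
  map_fn := by
    rintro F x _ ⟨y, hy, rfl⟩
    exact f.map_fn F x ⟨y, hy, rfl⟩

theorem Hom.IsEmbedding.codRestrict {f : Hom Γ A B} (hf : f.IsEmbedding) (S : Substruc B)
    (h : ∀ x, f.toFun x ∈ S.carrier) : (f.codRestrict S h).IsEmbedding where
  injective x y hxy := hf.injective (congrArg Subtype.val hxy)
  rel_iff R x := hf.rel_iff R x
  fn_eq F x := by
    refine Set.Subset.antisymm ((f.codRestrict S h).map_fn F x) ?_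
    rintro ⟨y, hyS⟩ hy
    have hy' : y ∈ B.fn (f.lang.1.2 F) (f.toFun x) := hy
    rw [← hf.fn_eq] at hy'
    obtain ⟨z, hz, rfl⟩ := hy'
    exact ⟨z, hz, rfl⟩

/-- The preimage of a substructure under a homomorphism. -/
def Hom.comap (f : Hom Γ A B) (S : Substruc B) : Substruc A where
  carrier := f.toFun ⁻¹' S.carrier
  closed F x hx y hy := S.closed _ _ hx (f.map_fn F x ⟨y, hy, rfl⟩)

theorem IsFreeAmalgamOf.comap {U₁ U₂ : Substruc B} (h : IsFreeAmalgamOf B U₁ U₂)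
    (f : Hom Γ A B) : IsFreeAmalgamOf A (f.comap U₁) (f.comap U₂) := by
  refine ⟨Set.eq_univ_of_forall fun x => ?_, fun R x hx => ?_⟩
  · have : f.toFun x ∈ U₁.carrier ∪ U₂.carrier := h.1 ▸ Set.mem_univ _
    exact this
  · exact h.2 _ _ (f.map_rel R x hx)

/-- A surjective homomorphic image of an irreducible structure is irreducible. -/
theorem IsIrreducible.of_surjective (hA : IsIrreducible A) (f : Hom Γ A B)
    (hf : Function.Surjective f.toFun) : IsIrreducible B := by
  rintro ⟨U₁, U₂, h₁, h₂, h⟩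
  have key : ∀ U : Substruc B, U.carrier ≠ Set.univ → (f.comap U).carrier ≠ Set.univ := by
    intro U hU hU'
    refine hU (Set.eq_univ_of_forall fun y => ?_)
    obtain ⟨x, rfl⟩ := hf y
    have : x ∈ (f.comap U).carrier := hU' ▸ Set.mem_univ x
    exact this
  exact hA ⟨_, _, key U₁ h₁, key U₂ h₂, h.comap f⟩

/-- The image of a substructure under an embedding. -/
def Hom.mapSub (f : Hom Γ A B) (hf : f.IsEmbedding) (S : Substruc A) : Substruc B :=
  (f.comp (S.incl Γ)).image (hf.comp S.incl_isEmbedding)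

theorem IsIrreducible.image {f : Hom Γ A B} (hA : IsIrreducible A) (hf : f.IsEmbedding) :
    IsIrreducible (f.image hf).toStruc := by
  refine hA.of_surjective (f.codRestrict (f.image hf) fun x => ⟨x, rfl⟩) ?_
  rintro ⟨_, x, rfl⟩
  exact ⟨x, rfl⟩

/-- The image of an irreducible structure is an irreducible substructure, to which the defining
property applies. This is also why homomorphism-embeddings compose. -/
theorem Hom.IsHomEmbedding.comp_isEmbedding {f : Hom Γ B C} (hf : f.IsHomEmbedding)
    {j : Hom Γ A B} (hj : j.IsEmbedding) (hA : IsIrreducible A) : (f.comp j).IsEmbedding :=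
  (hf (j.image hj) (hA.image hj)).comp (hj.codRestrict (j.image hj) fun x => ⟨x, rfl⟩)

theorem Hom.IsHomEmbedding.comp {g : Hom Γ B C} (hg : g.IsHomEmbedding) {f : Hom Γ A B}
    (hf : f.IsHomEmbedding) : (g.comp f).IsHomEmbedding :=
  fun S hS => hg.comp_isEmbedding (hf S hS) hS

theorem Hom.IsEmbedding.isHomEmbedding {f : Hom Γ A B} (hf : f.IsEmbedding) :
    f.IsHomEmbedding :=
  fun S _ => hf.comp S.incl_isEmbedding

/-- An irreducible substructure of a free amalgamation lies in one of the two parts. -/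
theorem IsFreeAmalgamOf.subset_or {U₁ U₂ W : Substruc A} (h : IsFreeAmalgamOf A U₁ U₂)
    (hW : IsIrreducible W.toStruc) : W.carrier ⊆ U₁.carrier ∨ W.carrier ⊆ U₂.carrier := by
  by_contra! hn
  have key : ∀ U : Substruc A, ¬ W.carrier ⊆ U.carrier →
      ((W.incl ⊤).comap U).carrier ≠ Set.univ := by
    intro U hU hU'
    refine hU fun y hy => ?_
    have : (⟨y, hy⟩ : W.carrier) ∈ ((W.incl ⊤).comap U).carrier := hU' ▸ Set.mem_univ _
    exact this
  exact hW ⟨_, _, key U₁ hn.1, key U₂ hn.2, h.comap (W.incl ⊤)⟩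

theorem IsFreeAmalgamOf.tuple_subset {U₁ U₂ : Substruc A} (h : IsFreeAmalgamOf A U₁ U₂)
    {n : ℕ+} {R : L.Rel n} {x : Fin n → A.V} (hx : x ∈ A.rel R) :
    (∀ i, x i ∈ U₁.carrier) ∨ (∀ i, x i ∈ U₂.carrier) := by
  by_contra! hn
  obtain ⟨⟨i, hi⟩, j, hj⟩ := hn
  have key : ∀ i, x i ∈ U₁.carrier ∨ x i ∈ U₂.carrier := fun i => by
    have : x i ∈ U₁.carrier ∪ U₂.carrier := h.1 ▸ Set.mem_univ _
    exact this
  exact h.2 R x hx ⟨⟨j, (key j).resolve_right hj, hj⟩, ⟨i, (key i).resolve_left hi, hi⟩⟩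

/-- If every vertex and every related tuple of an irreducible structure lies in a member of a
family of substructures, then any two vertices lie in a common member. -/
theorem IsIrreducible.exists_common (hA : IsIrreducible A) (𝓕 : Set (Substruc A))
    (hv : ∀ x, ∃ W ∈ 𝓕, x ∈ W.carrier)
    (ht : ∀ {n : ℕ+} (R : L.Rel n), ∀ x ∈ A.rel R, ∃ W ∈ 𝓕, ∀ i, x i ∈ W.carrier) (u v : A.V) :
    ∃ W ∈ 𝓕, u ∈ W.carrier ∧ v ∈ W.carrier := by
  by_contra! hn
  -- These are the vertices whose generated substructure omits `u`. It is proper, as it omits `u`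
  -- itself; a member of the family containing a vertex outside it must contain `u`.
  let avoid (u : A.V) : Substruc A :=
    { carrier := {z | ∃ W : Substruc A, z ∈ W.carrier ∧ u ∉ W.carrier}
      closed := fun F x ⟨W, hx, hu⟩ y hy => ⟨W, W.closed F x hx hy, hu⟩ }
  have hmem : ∀ u z, z ∉ (avoid u).carrier → ∀ W : Substruc A, z ∈ W.carrier → u ∈ W.carrier := by
    intro u z hz W hW
    by_contra hu
    exact hz ⟨W, hW, hu⟩
  have hprop : ∀ u, (avoid u).carrier ≠ Set.univ := by
    intro u h
    obtain ⟨W, h1, h2⟩ : u ∈ (avoid u).carrier := h ▸ Set.mem_univ u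
    exact h2 h1
  refine hA ⟨avoid u, avoid v, hprop u, hprop v, Set.eq_univ_of_forall fun z => ?_, ?_⟩
  · by_contra hz
    rw [Set.mem_union, not_or] at hz
    obtain ⟨W, hW, hzW⟩ := hv z
    exact hn W hW (hmem u z hz.1 W hzW) (hmem v z hz.2 W hzW)
  · rintro n R x hx ⟨⟨i, -, hi⟩, ⟨j, -, hj⟩⟩
    obtain ⟨W, hW, hxW⟩ := ht R x hx
    exact hn W hW (hmem u _ hj W (hxW j)) (hmem v _ hi W (hxW i))

/-! ### Completability and free amalgamation -/

/-- `A` has a homomorphism-embedding to a member of `K`. -/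
def Completable (Γ : Subgroup L.SymPerm) (K : Set (Struc.{u, v, w} L)) (A : Struc.{u, v, w} L) :
    Prop :=
  ∃ C ∈ K, ∃ f : Hom Γ A C, f.IsHomEmbedding

theorem Completable.of_hom {K : Set (Struc.{u, v, w} L)} (h : Completable Γ K B) {f : Hom Γ A B}
    (hf : f.IsHomEmbedding) : Completable Γ K A := by
  obtain ⟨C, hC, g, hg⟩ := h
  exact ⟨C, hC, g.comp f, hg.comp hf⟩

/-- The inclusion between two substructures. -/
def Substruc.inclusion (Γ : Subgroup L.SymPerm) {S T : Substruc A} (h : S.carrier ⊆ T.carrier) :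
    Hom Γ S.toStruc T.toStruc :=
  (S.incl Γ).codRestrict T fun x => h x.2

theorem Substruc.inclusion_isEmbedding {S T : Substruc A} (h : S.carrier ⊆ T.carrier) :
    (Substruc.inclusion Γ h).IsEmbedding :=
  S.incl_isEmbedding.codRestrict T fun x => h x.2

/-- Completability passes to free amalgamations over irreducible structures. -/
theorem Completable.of_freeAmalgam {K : Set (Struc.{u, v, w} L)} (hher : IsHereditary Γ K)
    (ham : HasAmalgamation Γ K) {U₁ U₂ D : Substruc A} (h : IsFreeAmalgamOf A U₁ U₂)
    (hD : D.carrier = U₁.carrier ∩ U₂.carrier) (hDirr : IsIrreducible D.toStruc)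
    (h₁ : Completable Γ K U₁.toStruc) (h₂ : Completable Γ K U₂.toStruc) : Completable Γ K A := by
  classical
  obtain ⟨C₁, hC₁, f₁, hf₁⟩ := h₁
  obtain ⟨C₂, hC₂, f₂, hf₂⟩ := h₂
  have hD₁ : D.carrier ⊆ U₁.carrier := hD ▸ Set.inter_subset_left
  have hD₂ : D.carrier ⊆ U₂.carrier := hD ▸ Set.inter_subset_right
  -- Irreducibility of the common part makes both restrictions embeddings, as the amalgamation
  -- property requires.
  have he₁ := hf₁.comp_isEmbedding (Substruc.inclusion_isEmbedding (Γ := Γ) hD₁) hDirr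
  have he₂ := hf₂.comp_isEmbedding (Substruc.inclusion_isEmbedding (Γ := Γ) hD₂) hDirr
  obtain ⟨C, hC, β₁, β₂, hβ₁, hβ₂, hβ⟩ :=
    ham _ (hher C₁ hC₁ _ ⟨_, he₁⟩) _ hC₁ _ hC₂ _ _ he₁ he₂
  have hlang : β₁.lang * f₁.lang = β₂.lang * f₂.lang := by
    have := congrArg Hom.lang hβ
    simpa [Hom.comp, Substruc.inclusion, Hom.codRestrict, Substruc.incl] using this
  have hfun : ∀ (x : A.V) (hx₁ : x ∈ U₁.carrier) (hx₂ : x ∈ U₂.carrier),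
      β₁.toFun (f₁.toFun ⟨x, hx₁⟩) = β₂.toFun (f₂.toFun ⟨x, hx₂⟩) := by
    intro x hx₁ hx₂
    exact congrFun (congrArg Hom.toFun hβ) ⟨x, hD ▸ ⟨hx₁, hx₂⟩⟩
  have hcov : ∀ x, x ∉ U₁.carrier → x ∈ U₂.carrier := fun x hx => by
    have : x ∈ U₁.carrier ∪ U₂.carrier := h.1 ▸ Set.mem_univ _
    exact this.resolve_left hx
  let g : A.V → C.V := fun x => if hx : x ∈ U₁.carrier then β₁.toFun (f₁.toFun ⟨x, hx⟩)
    else β₂.toFun (f₂.toFun ⟨x, hcov x hx⟩)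
  have hg₁ : ∀ x (hx : x ∈ U₁.carrier), g x = β₁.toFun (f₁.toFun ⟨x, hx⟩) :=
    fun x hx => dif_pos hx
  have hg₂ : ∀ x (hx : x ∈ U₂.carrier), g x = β₂.toFun (f₂.toFun ⟨x, hx⟩) := by
    intro x hx
    by_cases hx₁ : x ∈ U₁.carrier
    · rw [hg₁ x hx₁, hfun]
    · exact dif_neg hx₁
  let G : Hom Γ A C :=
    { lang := β₁.lang * f₁.lang
      toFun := g
      map_rel := by
        intro n R x hx
        rcases h.tuple_subset hx with hU | hU
        · have := (β₁.comp f₁).map_rel R (fun i => ⟨x i, hU i⟩) hx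
          have e : (fun i => g (x i)) = fun i => (β₁.comp f₁).toFun ⟨x i, hU i⟩ :=
            funext fun i => hg₁ _ (hU i)
          rw [e]; exact this
        · have := (β₂.comp f₂).map_rel R (fun i => ⟨x i, hU i⟩) hx
          have e : (fun i => g (x i)) = fun i => (β₂.comp f₂).toFun ⟨x i, hU i⟩ :=
            funext fun i => hg₂ _ (hU i)
          rw [e, hlang]; exact this
      map_fn := by
        rintro F x _ ⟨y, hy, rfl⟩
        by_cases hx : x ∈ U₁.carrier
        · have := (β₁.comp f₁).map_fn F ⟨x, hx⟩
            ⟨(⟨y, U₁.closed F x hx hy⟩ : U₁.carrier), hy, rfl⟩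
          rw [hg₁ x hx, hg₁ y (U₁.closed F x hx hy)]; exact this
        · have hx := hcov x hx
          have := (β₂.comp f₂).map_fn F ⟨x, hx⟩
            ⟨(⟨y, U₂.closed F x hx hy⟩ : U₂.carrier), hy, rfl⟩
          rw [hg₂ x hx, hg₂ y (U₂.closed F x hx hy), hlang]; exact this }
  refine ⟨C, hC, G, fun W hW => ?_⟩
  rcases h.subset_or hW with hU | hU
  · have e : G.restrict W = (β₁.comp f₁).comp (Substruc.inclusion Γ hU) :=
      Hom.ext (mul_one _).symm (funext fun x => hg₁ _ (hU x.2))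
    rw [e]
    exact (hβ₁.isHomEmbedding.comp hf₁).comp_isEmbedding (Substruc.inclusion_isEmbedding hU) hW
  · have e : G.restrict W = (β₂.comp f₂).comp (Substruc.inclusion Γ hU) :=
      Hom.ext (hlang.trans (mul_one _).symm) (funext fun x => hg₂ _ (hU x.2))
    rw [e]
    exact (hβ₂.isHomEmbedding.comp hf₂).comp_isEmbedding (Substruc.inclusion_isEmbedding hU) hW

/-! ### Combinatorics of flows and cells -/

section Flow

open scoped Classical in
/-- A chain modulo 2 on the incidence graph of a finite family of sets `s`, in two copies, with
boundary `T + a` on the second copy. -/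
structure IsFlow {V I : Type*} [Fintype I] (s : I → Set V) (a T : I) (c : I → I → ZMod 2) :
    Prop where
  supp : ∀ D T', c D T' ≠ 0 → s D ⊆ s T'
  row : ∀ D, ∑ T', c D T' = 0
  col : ∀ T', ∑ D, c D T' = (Pi.single T 1 : I → ZMod 2) T' + (Pi.single a 1 : I → ZMod 2) T'

open scoped Classical in
/-- The chain `c` outside of the star of the point `x`. -/
noncomputable def mask {V I : Type*} (s : I → Set V) (x : V) (c : I → I → ZMod 2) :
    I → I → ZMod 2 :=
  fun D T => if x ∈ s D then 0 else c D T

/-- The points of the covering of `V` given by the flows. -/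
def FlowLift {V I : Type*} [Fintype I] (s : I → Set V) (a : I) :=
  {v : V × (I → I → ZMod 2) // ∃ T c, IsFlow s a T c ∧ v.1 ∈ s T ∧ v.2 = mask s v.1 c}

variable {V I : Type*} {s : I → Set V} {a : I}

theorem mask_of_mem {x : V} {D : I} (h : x ∈ s D) (c : I → I → ZMod 2) (T : I) :
    mask s x c D T = 0 := if_pos h

theorem mask_of_notMem {x : V} {D : I} (h : x ∉ s D) (c : I → I → ZMod 2) (T : I) :
    mask s x c D T = c D T := if_neg h

variable [Fintype I]

/-- The lift of the set `s T` along a flow `c`. -/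
def flowCell (s : I → Set V) (a T : I) (c : I → I → ZMod 2) : Set (FlowLift s a) :=
  {v | v.1.1 ∈ s T ∧ v.1.2 = mask s v.1.1 c}

/-- The lifts of all members of the family. -/
def flowCells (s : I → Set V) (a : I) : Set (Set (FlowLift s a)) :=
  {K | ∃ T c, IsFlow s a T c ∧ K = flowCell s a T c}

theorem FlowLift.exists_cell (v : FlowLift s a) : ∃ K ∈ flowCells s a, v ∈ K := by
  obtain ⟨T, c, hc, h⟩ := v.2
  exact ⟨_, ⟨T, c, hc, rfl⟩, h⟩

theorem flowCells_injOn {K : Set (FlowLift s a)} (hK : K ∈ flowCells s a) {u v : FlowLift s a}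
    (hu : u ∈ K) (hv : v ∈ K) (h : u.1.1 = v.1.1) : u = v := by
  obtain ⟨T, c, -, rfl⟩ := hK
  refine Subtype.ext (Prod.ext h ?_)
  rw [hu.2, hv.2, h]

theorem zmod2_add_self (x : ZMod 2) : x + x = 0 := CharTwo.add_self_eq_zero x

/-- Points that pairwise lie in common cells lie in one cell. -/
theorem exists_flowCell_of_pairwise
    (hs : ∀ (Q : Set V) (T : I), Q ⊆ s T → ∃ D, Q ⊆ s D ∧ ∀ T', Q ⊆ s T' → s D ⊆ s T')
    (Q : Set (FlowLift s a))
    (hQ : ∀ u ∈ Q, ∀ v ∈ Q, ∃ K ∈ flowCells s a, u ∈ K ∧ v ∈ K) :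
    ∃ K ∈ flowCells s a, Q ⊆ K := by
  classical
  have hcompat : ∀ u ∈ Q, ∀ v ∈ Q, ∀ D T, u.1.1 ∉ s D → v.1.1 ∉ s D → u.1.2 D T = v.1.2 D T := by
    intro u hu v hv D T hD hD'
    obtain ⟨_, ⟨T', c, -, rfl⟩, h1, h2⟩ := hQ u hu v hv
    rw [h1.2, h2.2, mask_of_notMem hD, mask_of_notMem hD']
  -- Row `D` is visible at each point not over `s D`, and all these points agree on it. Rows
  -- invisible from all of `Q` are set to zero for now.
  let c₀ : I → I → ZMod 2 := fun D T =>
    if h : ∃ u ∈ Q, u.1.1 ∉ s D then h.choose.1.2 D T else 0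
  have hc₀ : ∀ u ∈ Q, ∀ D T, u.1.1 ∉ s D → c₀ D T = u.1.2 D T := by
    intro u hu D T hD
    have h : ∃ u ∈ Q, u.1.1 ∉ s D := ⟨u, hu, hD⟩
    simp only [c₀, dif_pos h]
    exact hcompat _ h.choose_spec.1 _ hu _ _ h.choose_spec.2 hD
  have hc₀' : ∀ D T, (∀ u ∈ Q, u.1.1 ∈ s D) → c₀ D T = 0 := by
    intro D T hD
    exact dif_neg fun ⟨u, hu, h⟩ => h (hD u hu)
  have hsupp : ∀ D T, c₀ D T ≠ 0 → s D ⊆ s T := by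
    intro D T h
    by_cases hD : ∀ u ∈ Q, u.1.1 ∈ s D
    · exact absurd (hc₀' D T hD) h
    · push Not at hD
      obtain ⟨u, hu, hD⟩ := hD
      obtain ⟨T', c, hc, -, he⟩ := u.2
      rw [hc₀ u hu D T hD, he, mask_of_notMem hD] at h
      exact hc.supp D T h
  have hrow : ∀ D, ∑ T, c₀ D T = 0 := by
    intro D
    by_cases hD : ∀ u ∈ Q, u.1.1 ∈ s D
    · exact Finset.sum_eq_zero fun T _ => hc₀' D T hD
    · push Not at hD
      obtain ⟨u, hu, hD⟩ := hD
      obtain ⟨T', c, hc, -, he⟩ := u.2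
      rw [← hc.row D]
      refine Finset.sum_congr rfl fun T _ => ?_
      rw [hc₀ u hu D T hD, he, mask_of_notMem hD]
  -- For a flow ending at `T` this would be the indicator of `T`. Columns not over all of `Q` are
  -- already correct, and since rows sum to zero the total is 1.
  let b : I → ZMod 2 := fun T => ∑ D, c₀ D T + (Pi.single a 1 : I → ZMod 2) T
  have hb : ∀ T, b T ≠ 0 → ∀ u ∈ Q, u.1.1 ∈ s T := by
    intro T hT u hu
    by_contra hx
    obtain ⟨T', c, hc, hT', he⟩ := u.2
    have h1 : ∑ D, c₀ D T = ∑ D, c D T := by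
      refine Finset.sum_congr rfl fun D _ => ?_
      by_cases hD : u.1.1 ∈ s D
      · have hDT : ¬ s D ⊆ s T := fun h => hx (h hD)
        rw [not_not.1 fun h => hDT (hsupp D T h), not_not.1 fun h => hDT (hc.supp D T h)]
      · rw [hc₀ u hu D T hD, he, mask_of_notMem hD]
    have hne : T ≠ T' := fun h => hx (h ▸ hT')
    apply hT
    simp only [b]
    rw [h1, hc.col, Pi.single_eq_of_ne hne, zero_add, zmod2_add_self]
  have hbsum : ∑ T, b T = 1 := by
    simp only [b]
    rw [Finset.sum_add_distrib, Finset.sum_comm, Finset.sum_eq_zero fun D _ => hrow D, zero_add,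
      Finset.sum_pi_single' a (1 : ZMod 2), if_pos (Finset.mem_univ a)]
  obtain ⟨T₁, hT₁⟩ : ∃ T, b T ≠ 0 := by
    by_contra! h
    rw [Finset.sum_eq_zero fun T _ => h T] at hbsum
    exact zero_ne_one hbsum
  obtain ⟨D₁, hD₁, hD₁'⟩ := hs ((fun u => u.1.1) '' Q) T₁
    (by rintro _ ⟨u, hu, rfl⟩; exact hb T₁ hT₁ u hu)
  have hQD : ∀ u ∈ Q, u.1.1 ∈ s D₁ := fun u hu => hD₁ ⟨u, hu, rfl⟩
  have hDb : ∀ T, b T ≠ 0 → s D₁ ⊆ s T := fun T hT =>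
    hD₁' T (by rintro _ ⟨u, hu, rfl⟩; exact hb T hT u hu)
  -- Row `D₁` is invisible from `Q`, so it can be altered freely to move the whole boundary error to
  -- `T₁`. The row still sums to zero because `b` and the indicator of `T₁` both have total 1.
  let c : I → I → ZMod 2 := fun D T =>
    c₀ D T + (if D = D₁ then b T + (Pi.single T₁ 1 : I → ZMod 2) T else 0)
  refine ⟨flowCell s a T₁ c, ⟨T₁, c, ⟨?_, ?_, ?_⟩, rfl⟩, ?_⟩
  · intro D T h
    by_cases hD : D = D₁
    · subst hD
      by_cases hT : T = T₁
      · subst hT; exact hDb _ hT₁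
      · simp only [c, if_true, Pi.single_eq_of_ne hT, add_zero, hc₀' D T hQD, zero_add] at h
        exact hDb T h
    · simp only [c, if_neg hD, add_zero] at h
      exact hsupp D T h
  · intro D
    simp only [c]
    rw [Finset.sum_add_distrib, hrow, zero_add]
    split_ifs
    · rw [Finset.sum_add_distrib, hbsum, Finset.sum_pi_single' T₁ (1 : ZMod 2),
        if_pos (Finset.mem_univ _), zmod2_add_self]
    · simp
  · intro T
    simp only [c]
    rw [Finset.sum_add_distrib, Finset.sum_ite_eq' Finset.univ D₁, if_pos (Finset.mem_univ _)]
    simp only [b]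
    generalize ∑ D, c₀ D T = t
    have := zmod2_add_self t
    linear_combination this
  · intro u hu
    refine ⟨hb T₁ hT₁ u hu, ?_⟩
    funext D T
    by_cases hD : u.1.1 ∈ s D
    · obtain ⟨T', c', hc', -, he⟩ := u.2
      rw [he, mask_of_mem hD, mask_of_mem hD]
    · have hne : D ≠ D₁ := fun h => hD (h ▸ hQD u hu)
      rw [mask_of_notMem hD]
      simp only [c, if_neg hne, add_zero]
      exact (hc₀ u hu D T hD).symm

/-- A finite set that is not contained in a cell, in which any two points whose projections lie
in a common member of the family lie in a common cell, can be separated over the intersection of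
two cells: no cell meets both sides of the predicate `P`. -/
theorem exists_separation
    (hs : ∀ (Q : Set V) (T : I), Q ⊆ s T → ∃ D, Q ⊆ s D ∧ ∀ T', Q ⊆ s T' → s D ⊆ s T')
    {C : Set (FlowLift s a)} (hfin : C.Finite) (hC : ¬ ∃ K ∈ flowCells s a, C ⊆ K)
    (hrefl : ∀ u ∈ C, ∀ v ∈ C, ∀ T, u.1.1 ∈ s T → v.1.1 ∈ s T →
      ∃ K ∈ flowCells s a, u ∈ K ∧ v ∈ K) :
    ∃ K₁ ∈ flowCells s a, ∃ K₂ ∈ flowCells s a, ∃ P : FlowLift s a → Prop,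
      (∀ K ∈ flowCells s a, ∀ u ∈ K ∩ C, ∀ v ∈ K ∩ C, u ∉ K₁ ∩ K₂ → v ∉ K₁ ∩ K₂ →
        (P u ↔ P v)) ∧
      (∃ u ∈ C, u ∉ K₁ ∩ K₂ ∧ P u) ∧ (∃ v ∈ C, v ∉ K₁ ∩ K₂ ∧ ¬ P v) := by
  classical
  -- the maximal intersections of cells with `C`
  let 𝓟 : Set (Set (FlowLift s a)) := {X | Maximal (fun X => ∃ K ∈ flowCells s a, X = K ∩ C) X}
  have hext : ∀ K ∈ flowCells s a, ∃ X ∈ 𝓟, K ∩ C ⊆ X := by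
    intro K hK
    have hf : {X | ∃ K ∈ flowCells s a, X = K ∩ C}.Finite :=
      hfin.finite_subsets.subset (by rintro _ ⟨K, -, rfl⟩; exact Set.inter_subset_right)
    obtain ⟨X, hX, hm⟩ := hf.exists_le_maximal (a := K ∩ C) ⟨K, hK, rfl⟩
    exact ⟨X, hm, hX⟩
  have h𝓟C : ∀ X ∈ 𝓟, X ⊆ C := by
    rintro X ⟨⟨K, -, rfl⟩, -⟩
    exact Set.inter_subset_right
  -- By `hrefl` the points of `C` over one member of the family pairwise share cells, hence share
  -- one cell.
  have htrace : ∀ T, ∃ X ∈ 𝓟, {u ∈ C | u.1.1 ∈ s T} ⊆ X := by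
    intro T
    obtain ⟨K, hK, h⟩ := exists_flowCell_of_pairwise hs {u ∈ C | u.1.1 ∈ s T}
      fun u hu v hv => hrefl u hu.1 v hv.1 T hu.2 hv.2
    obtain ⟨X, hX, h'⟩ := hext K hK
    exact ⟨X, hX, fun u hu => h' ⟨h hu, hu.1⟩⟩
  have hantichain : ∀ X ∈ 𝓟, ∀ Y ∈ 𝓟, X ⊆ Y → X = Y :=
    fun X hX Y hY h => Set.Subset.antisymm h (hX.2 hY.1 h)
  obtain ⟨X, hX, -⟩ := htrace a
  have hpair : ∃ Y ∈ 𝓟, Y ≠ X := by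
    have : ¬ C ⊆ X := fun h => by
      obtain ⟨K, hK, rfl⟩ := hX.1
      exact hC ⟨K, hK, fun u hu => (h hu).1⟩
    obtain ⟨u, hu, huX⟩ := Set.not_subset.1 this
    obtain ⟨K, hK, huK⟩ := u.exists_cell
    obtain ⟨Y, hY, h⟩ := hext K hK
    exact ⟨Y, hY, fun e => huX (e ▸ h ⟨huK, hu⟩)⟩
  obtain ⟨Y, hY, hYX⟩ := hpair
  -- Two distinct maximal traces with the largest possible intersection: anything strictly larger no
  -- longer separates traces.
  obtain ⟨⟨X₁, X₂⟩, ⟨hX₁, hX₂, hne⟩, hmax⟩ : ∃ p : Set (FlowLift s a) × Set (FlowLift s a),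
      (p.1 ∈ 𝓟 ∧ p.2 ∈ 𝓟 ∧ p.1 ≠ p.2) ∧
      ∀ q : Set (FlowLift s a) × Set (FlowLift s a), q.1 ∈ 𝓟 → q.2 ∈ 𝓟 → q.1 ≠ q.2 →
        (q.1 ∩ q.2).ncard ≤ (p.1 ∩ p.2).ncard := by
    have hf : {p : Set (FlowLift s a) × Set (FlowLift s a) |
        p.1 ∈ 𝓟 ∧ p.2 ∈ 𝓟 ∧ p.1 ≠ p.2}.Finite :=
      (hfin.finite_subsets.prod hfin.finite_subsets).subset
        fun p hp => ⟨h𝓟C _ hp.1, h𝓟C _ hp.2.1⟩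
    obtain ⟨p, hp, hm⟩ := Set.exists_max_image _ (fun p => (p.1 ∩ p.2).ncard) hf
      ⟨(Y, X), hY, hX, hYX⟩
    exact ⟨p, hp, fun q h1 h2 h3 => hm q ⟨h1, h2, h3⟩⟩
  dsimp only at hX₁ hX₂ hne hmax
  obtain ⟨K₁, hK₁, e₁⟩ := hX₁.1
  obtain ⟨K₂, hK₂, e₂⟩ := hX₂.1
  obtain ⟨T₁, c₁, hc₁, rfl⟩ := id hK₁
  obtain ⟨T₂, c₂, hc₂, rfl⟩ := id hK₂
  set K₁ := flowCell s a T₁ c₁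
  set K₂ := flowCell s a T₂ c₂
  -- Only rows visible from every point of `C` outside the separator are compared with `c₁`. Hence
  -- for such points `P` depends only on the flow of a cell containing them.
  let P : FlowLift s a → Prop := fun v =>
    ∀ D T, (∀ w ∈ C, w ∉ K₁ ∩ K₂ → w.1.1 ∉ s D) → v.1.2 D T = c₁ D T
  have hmemX : ∀ {v}, v ∈ C → (v ∉ K₁ ∩ K₂ ↔ v ∉ X₁ ∩ X₂) := by
    intro v hv
    rw [e₁, e₂]
    simp only [Set.mem_inter_iff, hv, and_true]
  have hPcell : ∀ T c, ∀ u ∈ flowCell s a T c ∩ C, u ∉ K₁ ∩ K₂ →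
      (P u ↔ ∀ D T, (∀ w ∈ C, w ∉ K₁ ∩ K₂ → w.1.1 ∉ s D) → c D T = c₁ D T) := by
    intro T c u hu hu'
    refine forall_congr' fun D => forall_congr' fun T => forall_congr' fun h => ?_
    rw [hu.1.2, mask_of_notMem (h u hu.2 hu')]
  refine ⟨K₁, hK₁, K₂, hK₂, P, ?_, ?_, ?_⟩
  · rintro _ ⟨T, c, -, rfl⟩ u hu v hv hu' hv'
    rw [hPcell T c u hu hu', hPcell T c v hv hv']
  · obtain ⟨u, hu, hu'⟩ := Set.not_subset.1 fun h => hne (hantichain X₁ hX₁ X₂ hX₂ h)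
    have huC := h𝓟C _ hX₁ hu
    have hu₀ : u ∉ K₁ ∩ K₂ := (hmemX huC).2 fun h => hu' h.2
    exact ⟨u, huC, hu₀, (hPcell T₁ c₁ u (e₁ ▸ hu) hu₀).2 fun _ _ _ => rfl⟩
  · obtain ⟨v, hv, hv'⟩ := Set.not_subset.1 fun h => hne (hantichain X₂ hX₂ X₁ hX₁ h).symm
    have hvC := h𝓟C _ hX₂ hv
    have hv₀ : v ∉ K₁ ∩ K₂ := (hmemX hvC).2 fun h => hv' h.1
    refine ⟨v, hvC, hv₀, fun hP => ?_⟩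
    rw [hPcell T₂ c₂ v (e₂ ▸ hv) hv₀] at hP
    -- the support of the difference of the two flows
    have hz : ∀ D T, c₁ D T + c₂ D T ≠ 0 →
        (∀ x ∈ X₁ ∩ X₂, x.1.1 ∈ s D) ∧ ∃ w ∈ C, w ∉ X₁ ∩ X₂ ∧ w.1.1 ∈ s D := by
      intro D T h
      constructor
      · intro x hx
        by_contra hxD
        have hx₁ : x ∈ K₁ := (e₁ ▸ hx.1 : x ∈ K₁ ∩ C).1
        have hx₂ : x ∈ K₂ := (e₂ ▸ hx.2 : x ∈ K₂ ∩ C).1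
        have := congrFun (congrFun (hx₁.2.symm.trans hx₂.2) D) T
        rw [mask_of_notMem hxD, mask_of_notMem hxD] at this
        rw [this, zmod2_add_self] at h
        exact h rfl
      · by_contra! hn
        have := hP D T fun w hw hw' => hn w hw ((hmemX hw).1 hw')
        rw [this, zmod2_add_self] at h
        exact h rfl
    -- If `P` held at `v`, the support of `c₁ + c₂` would satisfy `hz`. Then `W` is a union of
    -- components as far as this support is concerned, and it contains just one of the two boundary
    -- points `T₁`, `T₂`, which is impossible modulo 2.
    let W : Finset I := Finset.univ.filter fun T => {u ∈ C | u.1.1 ∈ s T} ⊆ X₁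
    have hW : ∀ D T T', s D ⊆ s T → s D ⊆ s T' → (∀ x ∈ X₁ ∩ X₂, x.1.1 ∈ s D) →
        (∃ w ∈ C, w ∉ X₁ ∩ X₂ ∧ w.1.1 ∈ s D) → T ∈ W → T' ∈ W := by
      rintro D T T' hDT hDT' hD ⟨w, hwC, hw, hwD⟩ hT
      simp only [W, Finset.mem_filter, Finset.mem_univ, true_and] at hT ⊢
      obtain ⟨X', hX', h⟩ := htrace T'
      by_cases hne' : X' = X₁
      · exact hne' ▸ h
      · exfalso
        -- Otherwise `X' ∩ X₁` contains `X₁ ∩ X₂` and also `w`, against the choice of the pair.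
        have hle := hmax (X', X₁) hX' hX₁ hne'
        refine absurd hle (not_le.2 (Set.ncard_lt_ncard ?_ ?_))
        · refine (Set.ssubset_iff_of_subset ?_).2 ⟨w, ⟨h ⟨hwC, hDT' hwD⟩, hT ⟨hwC, hDT hwD⟩⟩, hw⟩
          exact fun x hx => ⟨h ⟨h𝓟C _ hX₁ hx.1, hDT' (hD x hx)⟩, hx.1⟩
        · exact hfin.subset fun x hx => h𝓟C _ hX₁ hx.2
    have hT₁ : T₁ ∈ W := by
      simp only [W, Finset.mem_filter, Finset.mem_univ, true_and]
      obtain ⟨X', hX', h⟩ := htrace T₁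
      rw [hantichain X₁ hX₁ X' hX' fun x hx => h ⟨h𝓟C _ hX₁ hx, (e₁ ▸ hx : x ∈ K₁ ∩ C).1.1⟩]
      exact h
    have hT₂ : T₂ ∉ W := by
      simp only [W, Finset.mem_filter, Finset.mem_univ, true_and]
      exact fun h => hv' (h ⟨hvC, (e₂ ▸ hv : v ∈ K₂ ∩ C).1.1⟩)
    have hrows : ∀ D, ∑ T ∈ W, (c₁ D T + c₂ D T) = 0 := by
      intro D
      by_cases h : ∃ T ∈ W, c₁ D T + c₂ D T ≠ 0
      · obtain ⟨T, hT, hTz⟩ := h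
        have hsub : ∀ T, c₁ D T + c₂ D T ≠ 0 → s D ⊆ s T := by
          intro T h
          by_cases h1 : c₁ D T = 0
          · rw [h1, zero_add] at h; exact hc₂.supp D T h
          · exact hc₁.supp D T h1
        have hsum : ∑ T, (c₁ D T + c₂ D T) = 0 := by
          rw [Finset.sum_add_distrib, hc₁.row, hc₂.row, zero_add]
        rw [← hsum]
        refine Finset.sum_subset (Finset.subset_univ _) fun T' _ hT' => ?_
        by_contra hz'
        exact hT' (hW D T T' (hsub T hTz) (hsub T' hz') (hz D T hTz).1 (hz D T hTz).2 hT)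
      · push Not at h
        exact Finset.sum_eq_zero h
    -- Summed by rows the difference vanishes on `W`; summed by columns it gives 1.
    have htot : ∑ T ∈ W, ∑ D, (c₁ D T + c₂ D T) = 0 := by
      rw [Finset.sum_comm]
      exact Finset.sum_eq_zero fun D _ => hrows D
    have hcol : ∀ T ∈ W, ∑ D, (c₁ D T + c₂ D T) = (Pi.single T₁ 1 : I → ZMod 2) T := by
      intro T hT
      have hTne : T ≠ T₂ := fun h => hT₂ (h ▸ hT)
      rw [Finset.sum_add_distrib, hc₁.col, hc₂.col, Pi.single_eq_of_ne hTne, zero_add, add_assoc,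
        zmod2_add_self, add_zero]
    rw [Finset.sum_congr rfl hcol, Finset.sum_pi_single' T₁ (1 : ZMod 2), if_pos hT₁] at htot
    exact one_ne_zero htot

end Flow

/-! ### Isomorphisms, automorphisms and extensions along embeddings -/

theorem Hom.IsIsomorphism.bijective {f : Hom Γ A B} (hf : f.IsIsomorphism) :
    Function.Bijective f.toFun :=
  ⟨hf.injective, hf.surjective⟩

/-- The inverse of an isomorphism. -/
noncomputable def Hom.inverse (f : Hom Γ A B) (hf : f.IsIsomorphism) : Hom Γ B A where
  lang := f.lang⁻¹
  toFun := (Equiv.ofBijective f.toFun hf.bijective).symm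
  map_rel {n} R x hx := by
    rw [hf.rel_iff]
    have e : ∀ y, f.toFun ((Equiv.ofBijective f.toFun hf.bijective).symm y) = y :=
      Equiv.ofBijective_apply_symm_apply f.toFun _
    simp only [e]
    change x ∈ B.rel (f.lang.1.1 n ((f.lang.1.1 n).symm R))
    rwa [Equiv.apply_symm_apply]
  map_fn := by
    rintro F x _ ⟨y, hy, rfl⟩
    obtain ⟨x, rfl⟩ := hf.surjective x
    have h : y ∈ B.fn (f.lang.1.2 (f.lang.1.2.symm F)) (f.toFun x) := by
      rwa [Equiv.apply_symm_apply]
    rw [← hf.fn_eq] at h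
    obtain ⟨z, hz, rfl⟩ := h
    rw [Equiv.ofBijective_symm_apply_apply, Equiv.ofBijective_symm_apply_apply]
    exact hz

theorem Hom.inverse_apply_apply (f : Hom Γ A B) (hf : f.IsIsomorphism) (x : A.V) :
    (f.inverse hf).toFun (f.toFun x) = x :=
  Equiv.ofBijective_symm_apply_apply f.toFun _ x

theorem Hom.apply_inverse_apply (f : Hom Γ A B) (hf : f.IsIsomorphism) (y : B.V) :
    f.toFun ((f.inverse hf).toFun y) = y :=
  Equiv.ofBijective_apply_symm_apply f.toFun _ y

/-- A homomorphism with an inverse homomorphism is an isomorphism. -/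
theorem Hom.isIsomorphism_of_inverse (f : Hom Γ A B) (g : Hom Γ B A)
    (hl : g.lang * f.lang = 1) (hgf : ∀ x, g.toFun (f.toFun x) = x)
    (hfg : ∀ y, f.toFun (g.toFun y) = y) : f.IsIsomorphism := by
  have hl' : g.lang = f.lang⁻¹ := eq_inv_of_mul_eq_one_left hl
  refine ⟨⟨Function.LeftInverse.injective hgf, fun {n} R x => ⟨f.map_rel R x, fun h => ?_⟩,
    fun F x => Set.Subset.antisymm (f.map_fn F x) fun y hy => ⟨g.toFun y, ?_, hfg y⟩⟩,
    Function.RightInverse.surjective hfg⟩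
  · have := g.map_rel _ _ h
    simp only [hgf, hl'] at this
    change x ∈ A.rel ((f.lang.1.1 n).symm (f.lang.1.1 n R)) at this
    rwa [Equiv.symm_apply_apply] at this
  · have := g.map_fn _ _ ⟨y, hy, rfl⟩
    simp only [hgf, hl'] at this
    change g.toFun y ∈ A.fn (f.lang.1.2.symm (f.lang.1.2 F)) x at this
    rwa [Equiv.symm_apply_apply] at this

theorem Hom.inverse_isIsomorphism (f : Hom Γ A B) (hf : f.IsIsomorphism) :
    (f.inverse hf).IsIsomorphism :=
  (f.inverse hf).isIsomorphism_of_inverse f (mul_inv_cancel _) (f.apply_inverse_apply hf)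
    (f.inverse_apply_apply hf)

/-- An embedding as an isomorphism to its image. -/
def Hom.toImage (f : Hom Γ A B) (hf : f.IsEmbedding) : Hom Γ A (f.image hf).toStruc :=
  f.codRestrict (f.image hf) fun x => ⟨x, rfl⟩

theorem Hom.toImage_isIsomorphism (f : Hom Γ A B) (hf : f.IsEmbedding) :
    (f.toImage hf).IsIsomorphism where
  toIsEmbedding := hf.codRestrict _ _
  surjective := by
    rintro ⟨_, x, rfl⟩
    exact ⟨x, rfl⟩

/-- An automorphism as a homomorphism. -/
def Aut.toHom (g : Aut Γ B) : Hom Γ B B where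
  lang := g.1.1
  toFun := g.1.2
  map_rel R x hx := (g.2.1 R x).1 hx
  map_fn F x := (g.2.2 F x).subset

theorem Aut.toHom_isEmbedding (g : Aut Γ B) : (Aut.toHom g).IsEmbedding where
  injective := g.1.2.injective
  rel_iff := g.2.1
  fn_eq := g.2.2

/-- An automorphism given by an isomorphism. -/
noncomputable def Hom.toAut (f : Hom Γ B B) (hf : f.IsIsomorphism) : Aut Γ B :=
  ⟨(f.lang, Equiv.ofBijective f.toFun hf.bijective), hf.rel_iff, hf.fn_eq⟩

/-- The automorphism `g` extends the partial automorphism `p` along `ι`. -/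
def ExtendsAlong (ι : Hom Γ A B) (g : Aut Γ B) (p : PartialAut Γ A) : Prop :=
  g.1.1 * ι.lang = ι.lang * p.hom.lang ∧
  ∀ (x : A.V) (hx : x ∈ p.dom.carrier), g.1.2 (ι.toFun x) = ι.toFun (p.app x hx)

/-- A choice of automorphisms that maps coherent triples to coherent triples. -/
def IsCoherent (φ : PartialAut Γ A → Aut Γ B) : Prop :=
  ∀ f g h, CoherentTriple f g h → φ h = φ g * φ f

/-! ### Charts and the action of automorphisms on them -/

theorem Substruc.finite [Finite B.V] : Finite (Substruc B) :=
  Finite.of_injective Substruc.carrier fun _ _ h => Substruc.ext h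

/-- The substructures of `B` that embed in `A`. -/
def Chart (Γ : Subgroup L.SymPerm) (A B : Struc.{u, v, w} L) :=
  {S : Substruc B // ∃ f : Hom Γ S.toStruc A, f.IsEmbedding}

namespace Chart

/-- The vertex set of a chart. -/
def set (S : Chart Γ A B) : Set B.V := S.1.carrier

theorem set_injective : Function.Injective (set : Chart Γ A B → Set B.V) :=
  fun _ _ h => Subtype.ext (Substruc.ext h)

/-- A substructure of a chart is a chart. -/
def ofSubset (S : Substruc B) (T : Chart Γ A B) (h : S.carrier ⊆ T.set) : Chart Γ A B :=
  ⟨S, by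
    obtain ⟨f, hf⟩ := T.2
    exact ⟨_, hf.comp (Substruc.inclusion_isEmbedding h)⟩⟩

/-- The intersection of all charts containing `Q` is again a chart, being a substructure of one.
This supplies the hypothesis `hs` of the combinatorial lemmas. -/
theorem exists_least (Q : Set B.V) (T : Chart Γ A B) (h : Q ⊆ T.set) :
    ∃ D : Chart Γ A B, Q ⊆ D.set ∧ ∀ T' : Chart Γ A B, Q ⊆ T'.set → D.set ⊆ T'.set := by
  let D : Substruc B :=
    { carrier := {x | ∀ T' : Chart Γ A B, Q ⊆ T'.set → x ∈ T'.set}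
      closed := fun F x hx y hy T' hT' => T'.1.closed F x (hx T' hT') hy }
  exact ⟨ofSubset D T fun x hx => hx T h, fun x hx T' hT' => hT' hx, fun T' hT' x hx => hx T' hT'⟩

/-- The image of an embedding of `A`, as a chart. -/
noncomputable def ofHom (ι : Hom Γ A B) (hι : ι.IsEmbedding) : Chart Γ A B :=
  ⟨ι.image hι, _, ((ι.toImage hι).inverse_isIsomorphism (ι.toImage_isIsomorphism hι)).toIsEmbedding⟩

instance : SMul (Aut Γ B) (Chart Γ A B) where
  smul g S := ⟨(Aut.toHom g⁻¹).comap S.1, by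
    obtain ⟨f, hf⟩ := S.2
    exact ⟨_, hf.comp (((Aut.toHom_isEmbedding g⁻¹).comp
      (Substruc.incl_isEmbedding _)).codRestrict S.1 fun x => x.2)⟩⟩

theorem mem_smul {g : Aut Γ B} {S : Chart Γ A B} {x : B.V} :
    x ∈ (g • S).set ↔ (g⁻¹).1.2 x ∈ S.set := Iff.rfl

theorem apply_mem_smul {g : Aut Γ B} {S : Chart Γ A B} {x : B.V} :
    g.1.2 x ∈ (g • S).set ↔ x ∈ S.set := by
  rw [mem_smul]
  change g.1.2.symm (g.1.2 x) ∈ _ ↔ _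
  rw [Equiv.symm_apply_apply]

instance : MulAction (Aut Γ B) (Chart Γ A B) where
  one_smul S := set_injective rfl
  mul_smul g h S := set_injective <| by
    ext x
    rw [mem_smul, mem_smul, mem_smul, mul_inv_rev]
    rfl

theorem smul_set_subset_iff {g : Aut Γ B} {S T : Chart Γ A B} :
    (g • S).set ⊆ (g • T).set ↔ S.set ⊆ T.set := by
  constructor
  · intro h x hx
    exact apply_mem_smul.1 (h (apply_mem_smul.2 hx))
  · intro h x hx
    exact h hx

end Chart

noncomputable instance [Finite B.V] : Fintype (Chart Γ A B) :=
  have : Finite (Substruc B) := Substruc.finite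
  have : Finite (Chart Γ A B) := Subtype.finite
  Fintype.ofFinite _

/-- Meant for `y` a function value at `x`: charts are closed, so `y` lies in every chart containing
`x`, and the label at `x` determines the label at `y`. This lets functions lift to the cover. -/
theorem mask_mask {V I : Type*} {s : I → Set V} {x y : V} (h : ∀ D, x ∈ s D → y ∈ s D)
    (c : I → I → ZMod 2) : mask s y (mask s x c) = mask s y c := by
  funext D T
  by_cases hy : y ∈ s D
  · rw [mask_of_mem hy, mask_of_mem hy]
  · rw [mask_of_notMem hy, mask_of_notMem hy, mask_of_notMem fun hx => hy (h D hx)]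

theorem Chart.mem_of_mem_fn {F : L.Fn} {x y : B.V} (h : y ∈ B.fn F x) (D : Chart Γ A B)
    (hx : x ∈ D.set) : y ∈ D.set :=
  D.1.closed F x hx h

/-! ### The covering structure and its projection -/

section Lift

variable [Finite B.V]

/-- The covering structure of `B` on the lifts of its vertices, where a tuple is related if its
projection is and it lies in a cell. -/
def flowStruc (a : Chart Γ A B) : Struc.{u, v, w} L where
  V := FlowLift (Chart.set (Γ := Γ) (A := A) (B := B)) a
  rel R := {x | (fun i => (x i).1.1) ∈ B.rel R ∧ ∃ K ∈ flowCells Chart.set a, ∀ i, x i ∈ K}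
  fn F v := {y | y.1.1 ∈ B.fn F v.1.1 ∧ y.1.2 = mask Chart.set y.1.1 v.1.2}

variable {a : Chart Γ A B}

theorem flowStruc_finite : Finite (flowStruc a).V := by
  have : Finite (B.V × (Chart Γ A B → Chart Γ A B → ZMod 2)) := inferInstance
  exact Subtype.finite

theorem flowCell_closed {K : Set (flowStruc a).V} (hK : K ∈ flowCells Chart.set a) (F : L.Fn)
    (x : (flowStruc a).V) (hx : x ∈ K) : (flowStruc a).fn F x ⊆ K := by
  obtain ⟨T, c, -, rfl⟩ := hK
  rintro y ⟨hy, hy'⟩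
  refine ⟨Chart.mem_of_mem_fn hy _ hx.1, ?_⟩
  rw [hy', hx.2, mask_mask (Chart.mem_of_mem_fn hy)]

/-- A cell as a substructure. -/
def cellSub {K : Set (flowStruc a).V} (hK : K ∈ flowCells Chart.set a) :
    Substruc (flowStruc a) where
  carrier := K
  closed := flowCell_closed hK

theorem exists_mem_fn {v : (flowStruc a).V} {F : L.Fn} {y : B.V} (hy : y ∈ B.fn F v.1.1) :
    ∃ u ∈ (flowStruc a).fn F v, u.1.1 = y := by
  obtain ⟨T, c, hc, hT, he⟩ := v.2
  refine ⟨⟨(y, mask Chart.set y v.1.2), T, c, hc, Chart.mem_of_mem_fn hy T hT, ?_⟩, ⟨hy, rfl⟩, rfl⟩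
  change mask _ y v.1.2 = mask _ y c
  rw [he, mask_mask (Chart.mem_of_mem_fn hy)]

/-- The projection of the covering structure. -/
def flowProj (a : Chart Γ A B) : Hom Γ (flowStruc a) B where
  lang := 1
  toFun v := v.1.1
  map_rel _ _ hx := hx.1
  map_fn := by
    rintro F x _ ⟨y, hy, rfl⟩
    exact hy.1

/-- A cell has at most one point over each vertex, and inside a cell the relations are exactly those
of the projection. -/
theorem flowProj_isEmbedding_of_subset {S : Substruc (flowStruc a)} {K : Set (flowStruc a).V}
    (hK : K ∈ flowCells Chart.set a) (hS : S.carrier ⊆ K) :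
    ((flowProj a).comp (S.incl Γ)).IsEmbedding where
  injective x y h := Subtype.ext (flowCells_injOn hK (hS x.2) (hS y.2) h)
  rel_iff R x := ⟨fun h => h.1, fun h => ⟨h, K, hK, fun i => hS (x i).2⟩⟩
  fn_eq F x := by
    refine Set.Subset.antisymm (((flowProj a).comp (S.incl Γ)).map_fn F x) fun y hy => ?_
    obtain ⟨u, hu, rfl⟩ := exists_mem_fn hy
    exact ⟨⟨u, S.closed F x.1 x.2 hu⟩, hu, rfl⟩

theorem exists_embedding_of_subset_cell {S : Substruc (flowStruc a)} {K : Set (flowStruc a).V}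
    (hK : K ∈ flowCells Chart.set a) (hS : S.carrier ⊆ K) :
    ∃ f : Hom Γ S.toStruc A, f.IsEmbedding := by
  have hp := flowProj_isEmbedding_of_subset hK hS
  obtain ⟨T, c, -, rfl⟩ := hK
  obtain ⟨f, hf⟩ := T.2
  exact ⟨_, hf.comp (hp.codRestrict T.1 fun x => (hS x.2).1)⟩

/-- Cells cover all vertices and, by definition, all related tuples. Irreducibility therefore puts
any two vertices in a common cell, and pairwise common cells give a single one. -/
theorem exists_cell_of_irreducible {S : Substruc (flowStruc a)} (hS : IsIrreducible S.toStruc) :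
    ∃ K ∈ flowCells Chart.set a, S.carrier ⊆ K := by
  refine exists_flowCell_of_pairwise Chart.exists_least S.carrier fun u hu v hv => ?_
  have hv' : ∀ x : S.carrier, ∃ W ∈ {W | ∃ (K : _) (hK : K ∈ flowCells Chart.set a),
      W = (S.incl Γ).comap (cellSub hK)}, x ∈ W.carrier := by
    intro x
    obtain ⟨K, hK, h⟩ := FlowLift.exists_cell x.1
    exact ⟨_, ⟨K, hK, rfl⟩, h⟩
  obtain ⟨_, ⟨K, hK, rfl⟩, h₁, h₂⟩ := hS.exists_common _ hv'
    (fun R x ⟨_, K, hK, h⟩ => ⟨_, ⟨K, hK, rfl⟩, h⟩) ⟨u, hu⟩ ⟨v, hv⟩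
  exact ⟨K, hK, h₁, h₂⟩

theorem flowProj_isHomEmbedding : (flowProj a).IsHomEmbedding := by
  intro S hS
  obtain ⟨K, hK, h⟩ := exists_cell_of_irreducible hS
  exact flowProj_isEmbedding_of_subset hK h

/-! ### Automorphisms of the covering structure -/

/-- The action of automorphisms on chains. -/
def chainAct (g : Aut Γ B) (c : Chart Γ A B → Chart Γ A B → ZMod 2) :
    Chart Γ A B → Chart Γ A B → ZMod 2 :=
  fun D T => c (g⁻¹ • D) (g⁻¹ • T)

omit [Finite B.V] in
theorem chainAct_mul (g h : Aut Γ B) (c : Chart Γ A B → Chart Γ A B → ZMod 2) :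
    chainAct (g * h) c = chainAct g (chainAct h c) := by
  funext D T
  simp only [chainAct, mul_inv_rev, mul_smul]

end Lift

/-! ### Lifting automorphisms by flows -/

section LiftAut

variable [Finite B.V] {a : Chart Γ A B}

omit [Finite B.V] in
theorem chart_pi_single_smul (g : Aut Γ B) (S T : Chart Γ A B) [DecidableEq (Chart Γ A B)] :
    (Pi.single S 1 : Chart Γ A B → ZMod 2) (g⁻¹ • T) =
      (Pi.single (g • S) 1 : Chart Γ A B → ZMod 2) T := by
  simp only [Pi.single_apply, inv_smul_eq_iff]

/-- Translation by `g` moves the base to `g • a`; adding `z` brings it back to `a`, since the two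
contributions at `g • a` cancel modulo 2. -/
theorem IsFlow.act {T : Chart Γ A B} {c z : Chart Γ A B → Chart Γ A B → ZMod 2} {g : Aut Γ B}
    (hc : IsFlow Chart.set a T c) (hz : IsFlow Chart.set a (g • a) z) :
    IsFlow Chart.set a (g • T) (chainAct g c + z) where
  supp D T' h := by
    by_cases h' : z D T' = 0
    · rw [Pi.add_apply, Pi.add_apply, h', add_zero] at h
      exact Chart.smul_set_subset_iff.1 (hc.supp _ _ h)
    · exact hz.supp D T' h'
  row D := by
    simp only [Pi.add_apply, Finset.sum_add_distrib, hz.row, add_zero, chainAct]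
    rw [← hc.row (g⁻¹ • D)]
    exact Equiv.sum_comp (MulAction.toPerm g⁻¹) fun T => c (g⁻¹ • D) T
  col T' := by
    classical
    simp only [Pi.add_apply, Finset.sum_add_distrib, hz.col, chainAct]
    have : ∑ D, c (g⁻¹ • D) (g⁻¹ • T') = ∑ D, c D (g⁻¹ • T') :=
      Equiv.sum_comp (MulAction.toPerm g⁻¹) fun D => c D (g⁻¹ • T')
    rw [this, hc.col, chart_pi_single_smul, chart_pi_single_smul]
    have h2 := zmod2_add_self ((Pi.single (g • a) 1 : Chart Γ A B → ZMod 2) T')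
    linear_combination h2

omit [Finite B.V] in
theorem mask_chainAct (g : Aut Γ B) (x : B.V) (c : Chart Γ A B → Chart Γ A B → ZMod 2) :
    chainAct g (mask Chart.set x c) = mask Chart.set (g.1.2 x) (chainAct g c) := by
  funext D T
  have h : x ∈ (g⁻¹ • D).set ↔ g.1.2 x ∈ D.set := by
    rw [Chart.mem_smul, inv_inv]
  by_cases hD : g.1.2 x ∈ D.set
  · rw [mask_of_mem hD]
    exact mask_of_mem (h.2 hD) c _
  · rw [mask_of_notMem hD]
    exact mask_of_notMem (mt h.1 hD) c _

-- The rows forgotten at `x` are moved to the rows forgotten at the image of `x`, so the action on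
-- flows is well defined on labels.
omit [Finite B.V] in
theorem mask_chainAct_mask_add (g : Aut Γ B) (x : B.V)
    (c z : Chart Γ A B → Chart Γ A B → ZMod 2) :
    mask Chart.set (g.1.2 x) (chainAct g (mask Chart.set x c) + z) =
      mask Chart.set (g.1.2 x) (chainAct g c + z) := by
  rw [mask_chainAct]
  funext D T
  simp only [mask, Pi.add_apply]
  split_ifs <;> rfl

/-- The homomorphism of the covering structure given by an automorphism `g` and a flow that
corrects the displacement of the base chart. -/
noncomputable def liftHom (g : Aut Γ B) (z : Chart Γ A B → Chart Γ A B → ZMod 2)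
    (hz : IsFlow Chart.set a (g • a) z) : Hom Γ (flowStruc a) (flowStruc a) where
  lang := g.1.1
  toFun v := ⟨(g.1.2 v.1.1, mask Chart.set (g.1.2 v.1.1) (chainAct g v.1.2 + z)), by
    obtain ⟨T, c, hc, hT, he⟩ := v.2
    refine ⟨g • T, _, hc.act hz, Chart.apply_mem_smul.2 hT, ?_⟩
    dsimp only
    rw [he, mask_chainAct_mask_add]⟩
  map_rel := by
    rintro n R x ⟨hx, _, ⟨T, c, hc, rfl⟩, hK⟩
    refine ⟨(g.2.1 R _).1 hx, _, ⟨g • T, _, hc.act hz, rfl⟩, fun i => ⟨?_, ?_⟩⟩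
    · exact Chart.apply_mem_smul.2 (hK i).1
    · dsimp only
      rw [(hK i).2, mask_chainAct_mask_add]
  map_fn := by
    rintro F x _ ⟨y, ⟨hy, hy'⟩, rfl⟩
    have h : g.1.2 y.1.1 ∈ B.fn (g.1.1.1.2 F) (g.1.2 x.1.1) :=
      (g.2.2 F x.1.1).subset ⟨_, hy, rfl⟩
    refine ⟨h, ?_⟩
    dsimp only
    rw [hy', mask_chainAct_mask_add, mask_mask (Chart.mem_of_mem_fn h)]

omit [Finite B.V] in
theorem chainAct_add (g : Aut Γ B) (c d : Chart Γ A B → Chart Γ A B → ZMod 2) :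
    chainAct g (c + d) = chainAct g c + chainAct g d := rfl

/-- The condition `hyz` is the cocycle identity under which lifting is multiplicative. -/
theorem liftHom_comp_apply {g h k : Aut Γ B} {y z t : Chart Γ A B → Chart Γ A B → ZMod 2}
    (hy : IsFlow Chart.set a (g • a) y) (hz : IsFlow Chart.set a (h • a) z)
    (ht : IsFlow Chart.set a (k • a) t) (hk : k = g * h) (hyz : t = chainAct g z + y)
    (v : (flowStruc a).V) :
    (liftHom g y hy).toFun ((liftHom h z hz).toFun v) = (liftHom k t ht).toFun v := by
  subst hk hyz
  refine Subtype.ext (Prod.ext rfl ?_)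
  change mask _ (g.1.2 (h.1.2 v.1.1)) (chainAct g (mask _ (h.1.2 v.1.1) (chainAct h v.1.2 + z)) + y)
    = mask _ (g.1.2 (h.1.2 v.1.1)) (chainAct (g * h) v.1.2 + (chainAct g z + y))
  rw [mask_chainAct_mask_add, chainAct_add, chainAct_mul, add_assoc]

omit [Finite B.V] in
theorem chainAct_one (c : Chart Γ A B → Chart Γ A B → ZMod 2) : chainAct 1 c = c := by
  funext D T
  simp only [chainAct, inv_one, one_smul]

theorem isFlow_zero : IsFlow (Chart.set (Γ := Γ) (A := A) (B := B)) a a 0 where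
  supp _ _ h := absurd rfl h
  row _ := by simp
  col T' := by
    rw [zmod2_add_self]
    simp

theorem isFlow_one_smul : IsFlow (Chart.set (Γ := Γ) (A := A) (B := B)) a ((1 : Aut Γ B) • a) 0 :=
  (one_smul (Aut Γ B) a).symm ▸ isFlow_zero

theorem liftHom_one (v : (flowStruc a).V) :
    (liftHom (a := a) 1 0 isFlow_one_smul).toFun v = v := by
  refine Subtype.ext (Prod.ext rfl ?_)
  change mask _ v.1.1 (chainAct 1 v.1.2 + 0) = v.1.2
  obtain ⟨T, c, -, -, he⟩ := v.2
  rw [chainAct_one, add_zero, he, mask_mask fun _ h => h]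

theorem isFlow_inv {g : Aut Γ B} {z : Chart Γ A B → Chart Γ A B → ZMod 2}
    (hz : IsFlow Chart.set a (g • a) z) : IsFlow Chart.set a (g⁻¹ • a) (chainAct g⁻¹ z) where
  supp D T h := Chart.smul_set_subset_iff.1 (hz.supp _ _ h)
  row D := by
    rw [← hz.row (g⁻¹⁻¹ • D)]
    exact Equiv.sum_comp (MulAction.toPerm g⁻¹⁻¹) fun T => z (g⁻¹⁻¹ • D) T
  col T' := by
    have : ∑ D, z (g⁻¹⁻¹ • D) (g⁻¹⁻¹ • T') = ∑ D, z D (g⁻¹⁻¹ • T') :=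
      Equiv.sum_comp (MulAction.toPerm g⁻¹⁻¹) fun D => z D (g⁻¹⁻¹ • T')
    simp only [chainAct]
    rw [this, hz.col, chart_pi_single_smul, chart_pi_single_smul, inv_smul_smul, add_comm]

omit [Finite B.V] in
theorem chain_add_self (z : Chart Γ A B → Chart Γ A B → ZMod 2) : z + z = 0 := by
  funext D T
  exact zmod2_add_self _

theorem liftHom_isIsomorphism {g : Aut Γ B} {z : Chart Γ A B → Chart Γ A B → ZMod 2}
    (hz : IsFlow Chart.set a (g • a) z) : (liftHom g z hz).IsIsomorphism := by
  refine (liftHom g z hz).isIsomorphism_of_inverse (liftHom g⁻¹ _ (isFlow_inv hz))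
    (inv_mul_cancel g.1.1) (fun v => ?_) fun v => ?_
  · rw [liftHom_comp_apply _ _ isFlow_one_smul (inv_mul_cancel g).symm (chain_add_self _).symm,
      liftHom_one]
  · rw [liftHom_comp_apply _ _ isFlow_one_smul (mul_inv_cancel g).symm, liftHom_one]
    rw [← chainAct_mul, mul_inv_cancel, chainAct_one, chain_add_self]

/-- The automorphism of the covering structure given by an automorphism `g` and a flow that
corrects the displacement of the base chart. -/
noncomputable def liftAut (g : Aut Γ B) (z : Chart Γ A B → Chart Γ A B → ZMod 2)
    (hz : IsFlow Chart.set a (g • a) z) : Aut Γ (flowStruc a) :=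
  (liftHom g z hz).toAut (liftHom_isIsomorphism hz)

theorem liftAut_mul {g h k : Aut Γ B} {y z t : Chart Γ A B → Chart Γ A B → ZMod 2}
    (hy : IsFlow Chart.set a (g • a) y) (hz : IsFlow Chart.set a (h • a) z)
    (ht : IsFlow Chart.set a (k • a) t) (hk : k = g * h) (hyz : t = chainAct g z + y) :
    liftAut k t ht = liftAut g y hy * liftAut h z hz := by
  refine Subtype.ext (Prod.ext ?_ (Equiv.ext fun v => ?_))
  · subst hk; rfl
  · exact (liftHom_comp_apply hy hz ht hk hyz v).symm

open scoped Classical in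
/-- The flow from the base chart to its image under `g` through a common subchart `R`. -/
noncomputable def bridge (a R : Chart Γ A B) (g : Aut Γ B) :
    Chart Γ A B → Chart Γ A B → ZMod 2 :=
  fun D T => if D = R then (Pi.single a 1 : Chart Γ A B → ZMod 2) T +
    (Pi.single (g • a) 1 : Chart Γ A B → ZMod 2) T else 0

theorem bridge_isFlow {R : Chart Γ A B} {g : Aut Γ B} (h₁ : R.set ⊆ a.set)
    (h₂ : R.set ⊆ (g • a).set) : IsFlow Chart.set a (g • a) (bridge a R g) where
  supp D T h := by
    classical
    by_cases hD : D = R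
    · subst hD
      by_cases hT : T = a
      · exact hT ▸ h₁
      · by_cases hT' : T = g • a
        · exact hT' ▸ h₂
        · exact absurd (by simp [bridge, hT, hT']) h
    · exact absurd (if_neg hD) h
  row D := by
    classical
    simp only [bridge]
    split_ifs
    · rw [Finset.sum_add_distrib, Finset.sum_pi_single' a (1 : ZMod 2),
        Finset.sum_pi_single' (g • a) (1 : ZMod 2), if_pos (Finset.mem_univ _),
        if_pos (Finset.mem_univ _), zmod2_add_self]
    · simp
  col T := by
    classical
    simp only [bridge]
    rw [Finset.sum_ite_eq' Finset.univ R, if_pos (Finset.mem_univ _), add_comm]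

-- Both flows on the right live on row `R`, and their contributions at `g • a` cancel.
omit [Finite B.V] in
theorem bridge_mul (a R S : Chart Γ A B) (g h : Aut Γ B) (hS : g • S = R) :
    bridge a R (g * h) = chainAct g (bridge a S h) + bridge a R g := by
  classical
  subst hS
  funext D T
  simp only [bridge, chainAct, Pi.add_apply, inv_smul_eq_iff]
  split_ifs
  · rw [chart_pi_single_smul, chart_pi_single_smul, mul_smul]
    have h2 := zmod2_add_self ((Pi.single (g • a) 1 : Chart Γ A B → ZMod 2) T)
    linear_combination -h2
  · rw [add_zero]

end LiftAut

theorem PartialAut.exists_app (p : PartialAut Γ A) {y : A.V} (hy : y ∈ p.cod.carrier) :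
    ∃ (x : A.V) (hx : x ∈ p.dom.carrier), p.app x hx = y := by
  obtain ⟨x, hx⟩ := p.isIso.surjective ⟨y, hy⟩
  exact ⟨x.1, x.2, congrArg Subtype.val hx⟩

/-! ### Lifting the copy of the structure and the extensions -/

section BaseLift

variable [Finite B.V] (ι : Hom Γ A B) (hι : ι.IsEmbedding)

theorem mask_zero {V I : Type*} (s : I → Set V) (x : V) : mask s x 0 = 0 := by
  funext D T
  by_cases h : x ∈ s D
  · exact mask_of_mem h 0 T
  · exact mask_of_notMem h 0 T

/-- The lift of an embedding of `A` in `B` to the covering structure of `B`. -/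
noncomputable def baseLift : Hom Γ A (flowStruc (Chart.ofHom ι hι)) where
  lang := ι.lang
  toFun x := ⟨(ι.toFun x, 0), _, 0, isFlow_zero, ⟨x, rfl⟩, (mask_zero _ _).symm⟩
  map_rel R x hx := ⟨ι.map_rel R x hx, _, ⟨_, 0, isFlow_zero, rfl⟩,
    fun i => ⟨⟨x i, rfl⟩, (mask_zero _ _).symm⟩⟩
  map_fn := by
    rintro F x _ ⟨y, hy, rfl⟩
    exact ⟨ι.map_fn F x ⟨y, hy, rfl⟩, (mask_zero _ _).symm⟩

theorem baseLift_isEmbedding : (baseLift ι hι).IsEmbedding where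
  injective x y h := hι.injective (congrArg (fun v => v.1.1) h)
  rel_iff R x := ⟨(baseLift ι hι).map_rel R x, fun h => (hι.rel_iff R x).2 h.1⟩
  fn_eq F x := by
    refine Set.Subset.antisymm ((baseLift ι hι).map_fn F x) ?_
    rintro y ⟨hy, hy'⟩
    have hy₁ : y.1.1 ∈ B.fn (ι.lang.1.2 F) (ι.toFun x) := hy
    rw [← hι.fn_eq] at hy₁
    obtain ⟨z, hz, e⟩ := hy₁
    exact ⟨z, hz, Subtype.ext (Prod.ext e (hy'.trans (mask_zero _ _)).symm)⟩

/-- The image of the range of a partial automorphism, as a chart. -/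
noncomputable def rangeChart (p : PartialAut Γ A) : Chart Γ A B :=
  Chart.ofSubset (ι.mapSub hι p.cod) (Chart.ofHom ι hι) (by
    rintro _ ⟨x, rfl⟩
    exact ⟨x.1, rfl⟩)

omit [Finite B.V] in
theorem mem_rangeChart {p : PartialAut Γ A} {y : B.V} :
    y ∈ (rangeChart ι hι p).set ↔ ∃ x ∈ p.cod.carrier, ι.toFun x = y :=
  ⟨fun ⟨x, hx⟩ => ⟨x.1, x.2, hx⟩, fun ⟨x, hx, e⟩ => ⟨⟨x, hx⟩, e⟩⟩

variable {ι hι}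

theorem bridge_rangeChart {g : Aut Γ B} {p : PartialAut Γ A} (h : ExtendsAlong ι g p) :
    IsFlow Chart.set (Chart.ofHom ι hι) (g • Chart.ofHom ι hι)
      (bridge (Chart.ofHom ι hι) (rangeChart ι hι p) g) := by
  refine bridge_isFlow ?_ ?_
  · rintro y hy
    obtain ⟨x, -, rfl⟩ := (mem_rangeChart ι hι).1 hy
    exact ⟨x, rfl⟩
  · rintro y hy
    obtain ⟨x, hx, rfl⟩ := (mem_rangeChart ι hι).1 hy
    obtain ⟨z, hz, rfl⟩ := p.exists_app hx
    rw [← h.2 z hz, Chart.apply_mem_smul]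
    exact ⟨z, rfl⟩

variable (hι)

/-- The lift of an automorphism that extends a partial automorphism along `ι` to one that extends
it along the lift of `ι`. -/
noncomputable def liftExt {g : Aut Γ B} {p : PartialAut Γ A} (h : ExtendsAlong ι g p) :
    Aut Γ (flowStruc (Chart.ofHom ι hι)) :=
  liftAut g _ (bridge_rangeChart h)

/-- The lifted copy carries the zero label. The correcting flow lives on the single row of
`rangeChart`, which is forgotten at every point of the image of the range, so the label stays zero.
-/
theorem liftExt_extendsAlong {g : Aut Γ B} {p : PartialAut Γ A} (h : ExtendsAlong ι g p) :
    ExtendsAlong (baseLift ι hι) (liftExt hι h) p := by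
  refine ⟨h.1, fun x hx => Subtype.ext (Prod.ext (h.2 x hx) ?_)⟩
  change mask Chart.set (g.1.2 (ι.toFun x)) (chainAct g 0 + _) = 0
  funext D T
  by_cases hD : g.1.2 (ι.toFun x) ∈ D.set
  · exact mask_of_mem hD _ _
  · rw [mask_of_notMem hD]
    have hne : D ≠ rangeChart ι hι p := by
      rintro rfl
      exact hD ((mem_rangeChart ι hι).2 ⟨_, p.app_mem x hx, (h.2 x hx).symm⟩)
    change (0 : ZMod 2) + bridge _ _ _ D T = 0
    rw [zero_add]
    exact if_neg hne

/-- In a coherent triple `g` and `h` have the same range, and `φ g` carries the chart of the range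
of `f`, which is the domain of `g`, to that of the range of `g`. So `bridge_mul` applies. -/
theorem liftExt_isCoherent {φ : PartialAut Γ A → Aut Γ B} (hφ : ∀ p, ExtendsAlong ι (φ p) p)
    (hc : IsCoherent φ) : IsCoherent fun p => liftExt hι (hφ p) := by
  rintro f g h hfgh
  have hcod : g.cod = h.cod := hfgh.2.1
  have hR : rangeChart ι hι h = rangeChart ι hι g := by
    refine Chart.set_injective (Set.ext fun y => ?_)
    rw [mem_rangeChart, mem_rangeChart, hcod]
  have hS : φ g • rangeChart ι hι f = rangeChart ι hι g := by
    refine Chart.set_injective (Set.ext fun y => ?_)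
    obtain ⟨x, rfl⟩ := (φ g).1.2.surjective y
    rw [Chart.apply_mem_smul, mem_rangeChart, mem_rangeChart, hfgh.2.2.2.choose]
    constructor
    · rintro ⟨z, hz, rfl⟩
      exact ⟨_, g.app_mem z hz, ((hφ g).2 z hz).symm⟩
    · rintro ⟨z, hz, e⟩
      obtain ⟨t, ht, rfl⟩ := g.exists_app hz
      rw [← (hφ g).2 t ht] at e
      exact ⟨t, ht, (φ g).1.2.injective e⟩
  refine liftAut_mul _ _ _ (hc f g h hfgh) ?_
  rw [hc f g h hfgh, hR, bridge_mul _ _ _ _ _ hS]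

end BaseLift

/-! ### Defect and completability in the cover -/

/-- The number of pairs of vertices of `C` that do not lie in a common chart. -/
noncomputable def defect (Γ : Subgroup L.SymPerm) (A : Struc.{u, v, w} L) (C : Substruc B) : ℕ :=
  {p : B.V × B.V | p.1 ∈ C.carrier ∧ p.2 ∈ C.carrier ∧
    ¬ ∃ S : Chart Γ A B, p.1 ∈ S.set ∧ p.2 ∈ S.set}.ncard

section Step

variable [Finite B.V] {a : Chart Γ A B}

/-- The image of a substructure under the projection of the covering structure. -/
def projSub (C : Substruc (flowStruc a)) : Substruc B where
  carrier := (flowProj a).toFun '' C.carrier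
  closed := by
    rintro F _ ⟨x, hx, rfl⟩ y hy
    obtain ⟨u, hu, rfl⟩ := exists_mem_fn hy
    exact ⟨u, C.closed F x hx hu, rfl⟩

theorem completable_of_projSub {K : Set (Struc.{u, v, w} L)} {C : Substruc (flowStruc a)}
    (h : Completable Γ K (projSub C).toStruc) : Completable Γ K C.toStruc := by
  refine h.of_hom (f := ((flowProj a).comp (C.incl Γ)).codRestrict (projSub C)
    fun x => ⟨x.1, x.2, rfl⟩) fun S hS => ?_
  have := (flowProj_isHomEmbedding (a := a)).comp C.incl_isEmbedding.isHomEmbedding S hS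
  exact this.codRestrict (projSub C) fun x => ⟨x.1.1, x.1.2, rfl⟩

theorem exists_chart_iff_exists_cell (hirr : ∀ X : Struc.{u, v, w} L,
      (∃ f : Hom Γ X A, f.IsEmbedding) → IsIrreducible X) {u v : (flowStruc a).V} :
    (∃ S : Chart Γ A (flowStruc a), u ∈ S.set ∧ v ∈ S.set) ↔
      ∃ K ∈ flowCells Chart.set a, u ∈ K ∧ v ∈ K := by
  constructor
  · rintro ⟨S, hu, hv⟩
    obtain ⟨K, hK, h⟩ := exists_cell_of_irreducible (hirr _ S.2)
    exact ⟨K, hK, h hu, h hv⟩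
  · rintro ⟨K, hK, hu, hv⟩
    exact ⟨⟨cellSub hK, exists_embedding_of_subset_cell hK Set.Subset.rfl⟩, hu, hv⟩

theorem exists_chart_projSub (hirr : ∀ X : Struc.{u, v, w} L,
      (∃ f : Hom Γ X A, f.IsEmbedding) → IsIrreducible X) {u v : (flowStruc a).V}
    (h : ∃ S : Chart Γ A (flowStruc a), u ∈ S.set ∧ v ∈ S.set) :
    ∃ S : Chart Γ A B, u.1.1 ∈ S.set ∧ v.1.1 ∈ S.set := by
  obtain ⟨_, ⟨T, c, -, rfl⟩, hu, hv⟩ := (exists_chart_iff_exists_cell hirr).1 h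
  exact ⟨T, hu.1, hv.1⟩

/-- A common chart upstairs projects into a common chart downstairs, so each bad pair of the
projection lifts to a bad pair. -/
theorem defect_projSub_le (hirr : ∀ X : Struc.{u, v, w} L,
      (∃ f : Hom Γ X A, f.IsEmbedding) → IsIrreducible X) (C : Substruc (flowStruc a)) :
    defect Γ A (projSub C) ≤ defect Γ A C := by
  have : Finite (flowStruc a).V := flowStruc_finite
  refine (Set.ncard_le_ncard ?_ (Set.toFinite _)).trans
    (Set.ncard_image_le (f := fun p => (p.1.1.1, p.2.1.1)) (Set.toFinite _))
  rintro ⟨_, _⟩ ⟨⟨u, hu, rfl⟩, ⟨v, hv, rfl⟩, h⟩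
  exact ⟨(u, v), ⟨hu, hv, fun h' => h (exists_chart_projSub hirr h')⟩, rfl⟩

theorem defect_projSub_lt (hirr : ∀ X : Struc.{u, v, w} L,
      (∃ f : Hom Γ X A, f.IsEmbedding) → IsIrreducible X) {C : Substruc (flowStruc a)}
    {u v : (flowStruc a).V} (hu : u ∈ C.carrier) (hv : v ∈ C.carrier)
    (h₁ : ¬ ∃ S : Chart Γ A (flowStruc a), u ∈ S.set ∧ v ∈ S.set)
    (h₂ : ∃ S : Chart Γ A B, u.1.1 ∈ S.set ∧ v.1.1 ∈ S.set) :
    defect Γ A (projSub C) < defect Γ A C := by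
  have : Finite (flowStruc a).V := flowStruc_finite
  refine lt_of_le_of_lt ?_ (Set.ncard_sdiff_singleton_lt_of_mem
    (show (u, v) ∈ {p | _} from ⟨hu, hv, h₁⟩) (Set.toFinite _))
  refine (Set.ncard_le_ncard ?_ (Set.toFinite _)).trans
    (Set.ncard_image_le (f := fun p => (p.1.1.1, p.2.1.1)) (Set.toFinite _))
  rintro ⟨_, _⟩ ⟨⟨x, hx, rfl⟩, ⟨y, hy, rfl⟩, h⟩
  refine ⟨(x, y), ⟨⟨hx, hy, fun h' => h (exists_chart_projSub hirr h')⟩, ?_⟩, rfl⟩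
  intro e
  obtain ⟨rfl, rfl⟩ := Prod.mk.inj e
  exact h h₂

theorem defect_lt_of_subset {U C : Substruc B} (h : U.carrier ⊆ C.carrier)
    {x y : B.V} (hx : x ∈ C.carrier) (hy : y ∈ C.carrier) (hxU : x ∉ U.carrier ∨ y ∉ U.carrier)
    (hxy : ¬ ∃ S : Chart Γ A B, x ∈ S.set ∧ y ∈ S.set) : defect Γ A U < defect Γ A C := by
  refine Set.ncard_lt_ncard ((Set.ssubset_iff_of_subset ?_).2
    ⟨(x, y), ⟨hx, hy, hxy⟩, fun h' => ?_⟩) (Set.toFinite _)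
  · exact fun p hp => ⟨h hp.1, h hp.2.1, hp.2.2⟩
  · exact hxU.elim (fun h => h h'.1) fun h => h h'.2.1

/-- One covering raises the bound on the defect by one: unless the substructure lies in a cell, it
or each of two parts it is amalgamated from projects to a substructure of `B` of smaller defect. -/
theorem completable_of_defect_lt {K : Set (Struc.{u, v, w} L)} (hher : IsHereditary Γ K)
    (ham : HasAmalgamation Γ K) (hK : ∀ X ∈ K, IsIrreducible X) (hA : A ∈ K) {k : ℕ}
    (hB : ∀ C : Substruc B, defect Γ A C < k → Completable Γ K C.toStruc)
    (C : Substruc (flowStruc a)) (hC : defect Γ A C < k + 1) : Completable Γ K C.toStruc := by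
  have hfin : Finite (flowStruc a).V := flowStruc_finite
  have hirr : ∀ X : Struc.{u, v, w} L, (∃ f : Hom Γ X A, f.IsEmbedding) → IsIrreducible X :=
    fun X hX => hK X (hher A hA X hX)
  by_cases hcell : ∃ Q ∈ flowCells Chart.set a, C.carrier ⊆ Q
  · obtain ⟨Q, hQ, h⟩ := hcell
    obtain ⟨f, hf⟩ := exists_embedding_of_subset_cell hQ h
    exact ⟨A, hA, f, hf.isHomEmbedding⟩
  -- If some pair over a common chart shares no cell, it stops being bad under the projection, and
  -- the bound for `B` applies to the image.
  by_cases hrefl : ∀ u ∈ C.carrier, ∀ v ∈ C.carrier, ∀ T : Chart Γ A B, u.1.1 ∈ T.set →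
      v.1.1 ∈ T.set → ∃ Q ∈ flowCells Chart.set a, u ∈ Q ∧ v ∈ Q
  swap
  · push Not at hrefl
    obtain ⟨u, hu, v, hv, T, huT, hvT, h⟩ := hrefl
    refine completable_of_projSub (hB _ ?_)
    have := defect_projSub_lt hirr hu hv
      (fun h' => by
        obtain ⟨Q, hQ, h1, h2⟩ := (exists_chart_iff_exists_cell hirr).1 h'
        exact h Q hQ h1 h2) ⟨T, huT, hvT⟩
    omega
  obtain ⟨K₁, hK₁, K₂, hK₂, P, hP, ⟨u, hu, huK, huP⟩, ⟨v, hv, hvK, hvP⟩⟩ :=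
    exists_separation Chart.exists_least (Set.toFinite C.carrier) hcell hrefl
  have hclosed : ∀ F : L.Fn, ∀ x ∈ K₁ ∩ K₂, (flowStruc a).fn F x ⊆ K₁ ∩ K₂ := fun F x hx y hy =>
    ⟨flowCell_closed hK₁ F x hx.1 hy, flowCell_closed hK₂ F x hx.2 hy⟩
  -- Each side keeps the separator `K₁ ∩ K₂` and the points outside it with one value of `P`. It is
  -- closed because a vertex and its function values share a cell.
  let side (q : Prop) : Substruc (flowStruc a) :=
    { carrier := {x | x ∈ C.carrier ∧ (x ∉ K₁ ∩ K₂ → (P x ↔ q))}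
      closed := fun F x ⟨hx, hxq⟩ y hy => by
        refine ⟨C.closed F x hx hy, fun hy' => ?_⟩
        have hx' : x ∉ K₁ ∩ K₂ := fun h => hy' (hclosed F x h hy)
        obtain ⟨Q, hQ, hxQ⟩ := FlowLift.exists_cell x
        rw [← hxq hx']
        exact hP Q hQ y ⟨flowCell_closed hQ F x hxQ hy, C.closed F x hx hy⟩ x ⟨hxQ, hx⟩ hy' hx' }
  let D : Substruc (flowStruc a) :=
    { carrier := C.carrier ∩ (K₁ ∩ K₂)
      closed := fun F x hx y hy => ⟨C.closed F x hx.1 hy, hclosed F x hx.2 hy⟩ }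
  -- The separated points `u` and `v` form a bad pair, and each side omits one of them, so its
  -- defect drops.
  have huv : ¬ ∃ S : Chart Γ A (flowStruc a), u ∈ S.set ∧ v ∈ S.set := by
    intro h
    obtain ⟨Q, hQ, h1, h2⟩ := (exists_chart_iff_exists_cell hirr).1 h
    exact hvP ((hP Q hQ u ⟨h1, hu⟩ v ⟨h2, hv⟩ huK hvK).1 huP)
  have hside : ∀ q, (u ∉ (side q).carrier ∨ v ∉ (side q).carrier) →
      Completable Γ K (side q).toStruc := by
    intro q hq
    refine completable_of_projSub (hB _ ?_)
    have h1 := defect_projSub_le hirr (side q)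
    have h2 := defect_lt_of_subset (U := side q) (fun x hx => hx.1) hu hv hq huv
    omega
  have h₁ : Completable Γ K (side True).toStruc :=
    hside True (Or.inr fun h => hvP ((h.2 hvK).2 trivial))
  have h₂ : Completable Γ K (side False).toStruc :=
    hside False (Or.inl fun h => (h.2 huK).1 huP)
  have hsub : ∀ q, (side q).carrier ⊆ C.carrier := fun q x hx => hx.1
  have hDC : D.carrier ⊆ C.carrier := fun x hx => hx.1
  have mk : ∀ U : Substruc (flowStruc a), U.carrier ⊆ C.carrier →
      Completable Γ K U.toStruc → Completable Γ K ((C.incl Γ).comap U).toStruc := by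
    intro U hU h
    exact h.of_hom (Hom.IsEmbedding.isHomEmbedding
      ((C.incl_isEmbedding.comp (Substruc.incl_isEmbedding _)).codRestrict U fun x => x.2))
  refine Completable.of_freeAmalgam (U₁ := (C.incl Γ).comap (side True))
    (U₂ := (C.incl Γ).comap (side False)) (D := (C.incl Γ).comap D) hher ham ⟨?_, ?_⟩ ?_ ?_
    (mk _ (hsub _) h₁) (mk _ (hsub _) h₂)
  · refine Set.eq_univ_of_forall fun x => ?_
    by_cases hx : P x.1
    · exact Or.inl ⟨x.2, fun _ => iff_of_true hx trivial⟩
    · exact Or.inr ⟨x.2, fun _ => iff_of_false hx id⟩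
  · rintro n R x ⟨-, Q, hQ, hxQ⟩ ⟨⟨i, hi, hi'⟩, ⟨j, hj, hj'⟩⟩
    have hiK : (x i).1 ∉ K₁ ∩ K₂ := fun h => hi' ⟨(x i).2, fun h' => absurd h h'⟩
    have hjK : (x j).1 ∉ K₁ ∩ K₂ := fun h => hj' ⟨(x j).2, fun h' => absurd h h'⟩
    exact (hj.2 hjK).1 ((hP Q hQ _ ⟨hxQ i, (x i).2⟩ _ ⟨hxQ j, (x j).2⟩ hiK hjK).1
      ((hi.2 hiK).2 trivial))
  · ext x
    constructor
    · intro hx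
      exact ⟨⟨x.2, fun h => absurd hx.2 h⟩, ⟨x.2, fun h => absurd hx.2 h⟩⟩
    · rintro ⟨hx₁, hx₂⟩
      refine ⟨x.2, ?_⟩
      by_contra h
      exact (hx₂.2 h).1 ((hx₁.2 h).2 trivial)
  -- The separator is contained in the cell `K₁`, hence it embeds in `A` and is irreducible.
  · refine hirr _ ?_
    obtain ⟨f, hf⟩ := exists_embedding_of_subset_cell (S := D) hK₁ fun x hx => hx.2.1
    exact ⟨_, hf.comp ((C.incl_isEmbedding.comp (Substruc.incl_isEmbedding _)).codRestrict D
      fun x => x.2)⟩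

end Step

/-! ### Transport of partial automorphisms -/

/-- The pullback of a partial automorphism along an isomorphism. -/
noncomputable def PartialAut.pullback (e : Hom Γ A B) (he : e.IsIsomorphism)
    (q : PartialAut Γ B) : PartialAut Γ A where
  dom := e.comap q.dom
  cod := e.comap q.cod
  hom := (((e.inverse he).comp (q.cod.incl Γ)).codRestrict (e.comap q.cod) fun x => by
      change e.toFun ((e.inverse he).toFun x.1) ∈ q.cod.carrier
      rw [e.apply_inverse_apply]
      exact x.2).comp
    (q.hom.comp ((e.comp (Substruc.incl Γ _)).codRestrict q.dom fun x => x.2))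
  isIso :=
    { toIsEmbedding := (((e.inverse_isIsomorphism he).comp
        q.cod.incl_isEmbedding).codRestrict _ _).comp
        (q.isIso.comp ((he.comp (Substruc.incl_isEmbedding _)).codRestrict _ _))
      surjective := by
        rintro ⟨y, hy⟩
        obtain ⟨x, hx, hxy⟩ := q.exists_app hy
        obtain ⟨x, rfl⟩ := he.surjective x
        refine ⟨⟨x, hx⟩, Subtype.ext ?_⟩
        change (e.inverse he).toFun (q.app (e.toFun x) hx) = y
        rw [hxy, e.inverse_apply_apply] }

theorem PartialAut.apply_pullback_app (e : Hom Γ A B) (he : e.IsIsomorphism)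
    (q : PartialAut Γ B) (x : A.V) (hx : x ∈ (q.pullback e he).dom.carrier) :
    e.toFun ((q.pullback e he).app x hx) = q.app (e.toFun x) hx :=
  e.apply_inverse_apply he _

theorem PartialAut.pullback_lang (e : Hom Γ A B) (he : e.IsIsomorphism) (q : PartialAut Γ B) :
    (q.pullback e he).hom.lang = e.lang⁻¹ * q.hom.lang * e.lang := by
  change e.lang⁻¹ * 1 * (q.hom.lang * (e.lang * 1)) = _
  group

theorem CoherentTriple.pullback (e : Hom Γ A B) (he : e.IsIsomorphism) {f g h : PartialAut Γ B}
    (hfgh : CoherentTriple f g h) :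
    CoherentTriple (f.pullback e he) (g.pullback e he) (h.pullback e he) := by
  obtain ⟨h₁, h₂, h₃, h₄, h₅⟩ := hfgh
  refine ⟨congrArg e.comap h₁, congrArg e.comap h₂, ?_, congrArg e.comap h₄, fun x hf hh => ?_⟩
  · simp only [PartialAut.pullback_lang, h₃]
    group
  · refine he.injective ?_
    rw [PartialAut.apply_pullback_app, PartialAut.apply_pullback_app, h₅ (e.toFun x) hf hh]
    congr 1
    exact (PartialAut.apply_pullback_app e he f x hf).symm

/-- Extensions along an embedding give extensions of the partial automorphisms of its image. -/
theorem exists_extension_image {η : Hom Γ A B} (hη : η.IsEmbedding) {S : Substruc B}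
    (hS : S.carrier = Set.range η.toFun) {φ : PartialAut Γ A → Aut Γ B}
    (hφ : ∀ p, ExtendsAlong η (φ p) p) :
    ∃ φ' : PartialAut Γ S.toStruc → Aut Γ B, (∀ p, Extends (φ' p) p) ∧
      (IsCoherent φ → ∀ f g h, CoherentTriple f g h → φ' h = φ' g * φ' f) := by
  have hmem : ∀ x, η.toFun x ∈ S.carrier := fun x => hS ▸ ⟨x, rfl⟩
  let e : Hom Γ A S.toStruc := η.codRestrict S hmem
  have he : e.IsIsomorphism :=
    { toIsEmbedding := hη.codRestrict S hmem
      surjective := by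
        rintro ⟨y, hy⟩
        obtain ⟨x, rfl⟩ : y ∈ Set.range η.toFun := hS ▸ hy
        exact ⟨x, rfl⟩ }
  refine ⟨fun q => φ (q.pullback e he), fun q => ⟨?_, fun x hx => ?_⟩,
    fun hc f g h hfgh => hc _ _ _ (hfgh.pullback e he)⟩
  · have h := (hφ (q.pullback e he)).1
    rw [PartialAut.pullback_lang] at h
    change _ * η.lang = η.lang * (η.lang⁻¹ * q.hom.lang * η.lang) at h
    rw [← mul_assoc, ← mul_assoc, mul_inv_cancel, one_mul] at h
    exact mul_right_cancel h
  · obtain ⟨x, rfl⟩ := he.surjective x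
    refine ((hφ (q.pullback e he)).2 x hx).trans ?_
    exact congrArg Subtype.val (PartialAut.apply_pullback_app e he q x hx)

/-! ### Iterated covers and the theorem -/

/-- Iterating the covering construction makes all substructures of small defect completable. -/
theorem exists_completable_cover {K : Set (Struc.{u, v, w} L)} (hher : IsHereditary Γ K)
    (ham : HasAmalgamation Γ K) (hK : ∀ X ∈ K, IsIrreducible X) (hA : A ∈ K) [Finite B.V]
    {ι : Hom Γ A B} (hι : ι.IsEmbedding) {φ : PartialAut Γ A → Aut Γ B}
    (hφ : ∀ p, ExtendsAlong ι (φ p) p) (k : ℕ) :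
    ∃ B' : Struc.{u, v, w} L, Finite B'.V ∧ ∃ ι' : Hom Γ A B', ι'.IsEmbedding ∧
      (∃ φ' : PartialAut Γ A → Aut Γ B', (∀ p, ExtendsAlong ι' (φ' p) p) ∧
        (IsCoherent φ → IsCoherent φ')) ∧
      (∃ π : Hom Γ B' B, π.IsHomEmbedding) ∧
      (∀ C : Substruc B', defect Γ A C < k → Completable Γ K C.toStruc) ∧
      (0 < k → ∀ S : Substruc B', IsIrreducible S.toStruc →
        ∃ f : Hom Γ S.toStruc A, f.IsEmbedding) := by
  induction k with
  | zero =>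
    -- Irreducible substructures of `B` itself need not embed in `A`; this holds only after a first
    -- covering, hence the guard `0 < k`.
    refine ⟨B, ‹_›, ι, hι, ⟨φ, hφ, id⟩, ?_, fun C h => absurd h (Nat.not_lt_zero _),
      fun h => absurd h (lt_irrefl 0)⟩
    exact ⟨(Aut.toHom 1), (Aut.toHom_isEmbedding 1).isHomEmbedding⟩
  | succ k ih =>
    obtain ⟨B', hfin, ι', hι', ⟨φ', hφ', hc⟩, ⟨π, hπ⟩, hcomp, -⟩ := ih
    refine ⟨flowStruc (Chart.ofHom ι' hι'), flowStruc_finite, baseLift ι' hι',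
      baseLift_isEmbedding ι' hι', ⟨fun p => liftExt hι' (hφ' p),
        fun p => liftExt_extendsAlong hι' (hφ' p), fun h => liftExt_isCoherent hι' hφ' (hc h)⟩,
      ⟨π.comp (flowProj _), hπ.comp flowProj_isHomEmbedding⟩,
      completable_of_defect_lt hher ham hK hA hcomp, fun _ S hS => ?_⟩
    obtain ⟨Q, hQ, h⟩ := exists_cell_of_irreducible hS
    exact exists_embedding_of_subset_cell hQ h

theorem defect_le [Finite B.V] (C : Substruc B) :
    defect Γ A C ≤ C.carrier.ncard * C.carrier.ncard := by
  rw [← Set.ncard_prod]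
  exact Set.ncard_le_ncard (fun p hp => ⟨hp.1, hp.2.1⟩) (Set.toFinite _)

/-- A structure of `K` with an EPPA-witness in `E` has an EPPA-witness in `K`. -/
theorem exists_witness_mem {E K : Set (Struc.{u, v, w} L)} (hEfin : ∀ A ∈ E, Finite A.V)
    (hKirr : ∀ A ∈ K, IsIrreducible A) (hher : IsHereditary Γ K) (ham : HasAmalgamation Γ K)
    (hloc : IsLocallyFiniteAutPreserving Γ K E) (hA : A ∈ K) (hB : B ∈ E) (ψ : Hom Γ A B)
    (hψ : ψ.IsEmbedding) (φ : PartialAut Γ (ψ.image hψ).toStruc → Aut Γ B)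
    (hφ : ∀ p, Extends (φ p) p) :
    ∃ B' ∈ K, ∃ (ψ' : Hom Γ A B') (hψ' : ψ'.IsEmbedding)
      (φ' : PartialAut Γ (ψ'.image hψ').toStruc → Aut Γ B'), (∀ p, Extends (φ' p) p) ∧
      (IsCoherent φ → ∀ f g h, CoherentTriple f g h → φ' h = φ' g * φ' f) := by
  have hA₁ : (ψ.image hψ).toStruc ∈ K := hher A hA _ ⟨_,
    ((ψ.toImage hψ).inverse_isIsomorphism (ψ.toImage_isIsomorphism hψ)).toIsEmbedding⟩
  have := hEfin B hB
  obtain ⟨n, hn⟩ := hloc.2 _ hA₁ B hB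
  -- The defect counts ordered pairs, so it is at most `n * n` on `n` vertices, and the strict bound
  -- `n * n + 1` suffices. It is positive, so irreducible substructures are controlled even for `n =
  -- 0`.
  obtain ⟨B₁, hfin, ι, hι, ⟨φ₁, hφ₁, hc₁⟩, hπ, hcomp, hirr⟩ :=
    exists_completable_cover hher ham hKirr hA₁ (ψ.image hψ).incl_isEmbedding
      (fun p => ⟨(mul_one _).trans ((hφ p).1.trans (one_mul _).symm), (hφ p).2⟩) (n * n + 1)
  obtain ⟨B', hB', -, f, hf, -, Φ, hΦ⟩ := hn B₁ hfin (hirr (Nat.succ_pos _)) hπ fun S hS => by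
    obtain ⟨C, hC, g, hg⟩ := hcomp S (Nat.lt_succ_of_le
      ((defect_le S).trans (Nat.mul_le_mul hS hS)))
    exact ⟨C, hC, hKirr C hC, g, hg⟩
  have hη : (f.comp ι).IsEmbedding := hf.comp_isEmbedding hι (hKirr _ hA₁)
  have hψ' : ((f.comp ι).comp (ψ.toImage hψ)).IsEmbedding :=
    hη.comp (ψ.toImage_isIsomorphism hψ).toIsEmbedding
  have hrange : (Hom.image _ hψ').carrier = Set.range (f.comp ι).toFun :=
    (ψ.toImage_isIsomorphism hψ).surjective.range_comp (f.comp ι).toFun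
  -- Composing with `Φ` keeps coherence because `Φ` is a group homomorphism.
  obtain ⟨φ', hφ', hc'⟩ := exists_extension_image hη hrange (φ := fun p => Φ (φ₁ p)) fun p => by
    refine ⟨?_, fun x hx => ?_⟩
    · change (Φ (φ₁ p)).1.1 * (f.lang * ι.lang) = f.lang * ι.lang * p.hom.lang
      rw [← mul_assoc, (hΦ _).1, mul_assoc, (hφ₁ p).1, mul_assoc]
    · exact ((hΦ (φ₁ p)).2 _).trans (congrArg f.toFun ((hφ₁ p).2 x hx))
  refine ⟨B', hB', _, hψ', φ', hφ', fun hc => hc' fun f g h hfgh => ?_⟩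
  exact (congrArg Φ (hc₁ hc f g h hfgh)).trans (map_mul Φ _ _)

end GammaL

theorem theorem1p6 {L : GammaL.Lang.{u, v}} (Γ : Subgroup L.SymPerm)
    (E K : Set (GammaL.Struc.{u, v, w} L))
    (hEfin : ∀ A ∈ E, Finite A.V)
    (hE : GammaL.HasEPPA Γ E)
    (hKirr : ∀ A ∈ K, GammaL.IsIrreducible A)
    (hKher : GammaL.IsHereditary Γ K)
    (hKamalg : GammaL.HasAmalgamation Γ K)
    (hKloc : GammaL.IsLocallyFiniteAutPreserving Γ K E) :
    GammaL.HasEPPA Γ K ∧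
      (GammaL.HasCoherentEPPA Γ E → GammaL.HasCoherentEPPA Γ K) := by
  refine ⟨fun A hA => ?_, fun hcoh A hA => ?_⟩
  · obtain ⟨B, hB, ψ, hψ, h⟩ := hE A (hKloc.1 hA)
    choose φ hφ using h
    obtain ⟨B', hB', ψ', hψ', φ', hφ', -⟩ := GammaL.exists_witness_mem hEfin hKirr hKher hKamalg
      hKloc hA hB ψ hψ φ hφ
    exact ⟨B', hB', ψ', hψ', fun p => ⟨φ' p, hφ' p⟩⟩
  · obtain ⟨B, hB, ψ, hψ, φ, hφ, hc⟩ := hcoh A (hKloc.1 hA)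
    obtain ⟨B', hB', ψ', hψ', φ', hφ', hc'⟩ := GammaL.exists_witness_mem hEfin hKirr hKher hKamalg
      hKloc hA hB ψ hψ φ hφ
    exact ⟨B', hB', ψ', hψ', φ', hφ', hc' hc⟩
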